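/- Notation. For $p,q\ge 1$ let $[k,k]=k_1^2+\dots+k_q^2-k_{q+1}^2-\dots-k_{p+q}^2$ on $\mathbb R^{p+q}$, and let $SO_0(p,q)$ be the identity component of the group of linear maps preserving this form. It acts on functions on the cone $\{k\neq 0,\ [k,k]=0\}$ by $T(g)F(k)=F(g^{-1}k)$. Put $\omega(k)=(k_1^2+\dots+k_q^2)^{1/2}$; the section $\omega=1$ of the cone is $S^{q-1}\times S^{p-1}$, and $(F_1,F_2)$ denotes the integral of $F_1\overline{F_2}$ over this section with respect to the product of the normalized surface measures of the two unit spheres. For $\sigma\in\mathbb C$ let $F_0=\omega^\sigma$, the normalized $SO(p)\times SO(q)$-invariant vector of the even representation of degree $\sigma$. The zonal spherical function is $Z^{[p,q]}_\sigma(\alpha)=(T(g_\alpha)F_0,F_0)$, where $g_\alpha$ ($\alpha\in\mathbb R$) is the hyperbolic rotation $k_1\mapsto k_1\cosh\alpha+k_{p+q}\sinh\alpha$, $k_{p+q}\mapsto k_1\sinh\alpha+k_{p+q}\cosh\alpha$. Let $(a)_n=a(a+1)\cdots(a+n-1)$. For $l\in\mathbb N$, $F_2(a,-l,-l;c,c';1,1)=\sum_{m,n=0}^{l}\frac{(a)_{m+n}(-l)_m(-l)_n}{(c)_m(c')_n\,m!\,n!}$,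 and ${}_3F_2(a,-l,-l;d,e;1)=\sum_{n=0}^{l}\frac{(a)_n(-l)_n(-l)_n}{(d)_n(e)_n\,n!}$, which is defined when $(d)_n(e)_n\ne0$ for $0\le n\le l$. Statement. For all $\sigma\in\mathbb C$ and all $\alpha\in\mathbb R$ the following hold; all series over $l$ converge absolutely. 1. $Z_\sigma^{[4,1]}(\alpha)={}_2F_1\!\left(-\frac\sigma2,\frac{1-\sigma}2;2;\tanh^2\alpha\right)(\cosh\alpha)^\sigma.$ 2. $$Z_\sigma^{[3,2]}(\alpha)=\frac1{\cosh\alpha}\sum_{l=0}^\infty\frac{(\frac12)_l}{l!}F_2\!\left(-\tfrac\sigma2,-l,-l;\tfrac32,1;1,1\right)(\tanh\alpha)^{2l},$$ and, if $\sigma\notin\{-2,-3,-4,\dots\}$, also $$Z_\sigma^{[3,2]}(\alpha)=\frac1{\cosh\alpha}\sum_{l=0}^\infty\frac{(\frac12)_l(\frac{3+\sigma}2)_l(\frac\sigma2+1)_l}{(\frac32)_l\,(l!)^2}\;{}_3F_2\!\left(-\tfrac\sigma2,-l,-l;-\tfrac{\sigma+1}2-l,-\tfrac\sigma2-l;1\right)(\tanh\alpha)^{2l}.$$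 3. $$Z_\sigma^{[4,2]}(\alpha)=\frac1{\cosh\alpha}\sum_{l=0}^\infty\frac{(\frac12)_l}{l!}F_2\!\left(-\tfrac\sigma2,-l,-l;2,1;1,1\right)(\tanh\alpha)^{2l},$$ and, if $\sigma\notin\{-2,-4,-6,\dots\}$, also $$Z_\sigma^{[4,2]}(\alpha)=\frac1{\cosh\alpha}\sum_{l=0}^\infty\frac{(\frac12)_l(\frac\sigma2+2)_l(\frac\sigma2+1)_l}{(l!)^2\,\Gamma(l+2)}\;{}_3F_2\!\left(-\tfrac\sigma2,-l,-l;-\tfrac\sigma2-l-1,-\tfrac\sigma2-l;1\right)(\tanh\alpha)^{2l}.$$ The excluded values of $\sigma$ are exactly those at which some of the ${}_3F_2$ are undefined. For every $\sigma\in\mathbb C$, the excluded ones in particular, the last formulas of 2 and 3 also hold when the coefficient of each $(\tanh\alpha)^{2l}$ in the series is replaced by its limit as $s\to\sigma$, $s\ne\sigma$ (the coefficient being taken at $s$ instead of $\sigma$); these limits exist. -/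

import Mathlib

open scoped Topology
open MeasureTheory Matrix

noncomputable section

namespace ZonalSO

/-! ### The group `SO₀(p,q)` and its action on the cone `[k,k] = 0` -/

/-- The form `[k,k] = k₁² + … + k_q² - k_{q+1}² - … - k_{p+q}²`: the first `q` coordinates are
indexed by `Fin q`, the last `p` coordinates by `Fin p`. -/
def form (p q : ℕ) (k : Fin q ⊕ Fin p → ℝ) : ℝ :=
  ∑ i, k (Sum.inl i) ^ 2 - ∑ j, k (Sum.inr j) ^ 2

/-- The group of all linear motions that preserve the form `[k,k]`. -/
def motionGroup (p q : ℕ) : Subgroup (GL (Fin q ⊕ Fin p) ℝ) where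
  carrier := {g | ∀ k, form p q ((g : Matrix _ _ ℝ) *ᵥ k) = form p q k}
  one_mem' := by intro k; simp
  mul_mem' := by
    intro a b ha hb k
    rw [Units.val_mul, ← Matrix.mulVec_mulVec, ha, hb]
  inv_mem' := by
    intro a ha k
    have h := ha ((a⁻¹ : GL (Fin q ⊕ Fin p) ℝ).val *ᵥ k)
    rw [Matrix.mulVec_mulVec, ← Units.val_mul, mul_inv_cancel, Units.val_one,
      Matrix.one_mulVec] at h
    exact h.symm

/-- `SO₀(p,q)`: the connected component of the unit of the group of motions. -/
def SO₀ (p q : ℕ) : Subgroup (motionGroup p q) :=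
  Subgroup.connectedComponentOfOne (motionGroup p q)

/-- The cone `[k,k] = 0` without the point `k = 0`. -/
def Cone (p q : ℕ) : Type := {k : Fin q ⊕ Fin p → ℝ // k ≠ 0 ∧ form p q k = 0}

/-- The point `g k` of the cone. -/
def Cone.act {p q : ℕ} (g : SO₀ p q) (k : Cone p q) : Cone p q :=
  ⟨(g.1.1 : GL (Fin q ⊕ Fin p) ℝ).val *ᵥ k.1, by
    refine ⟨fun h => k.2.1 ?_, (g.1.2 k.1).trans k.2.2⟩
    have h2 : ((g.1.1⁻¹ : GL (Fin q ⊕ Fin p) ℝ) : Matrix _ _ ℝ) *ᵥ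
        ((g.1.1 : GL (Fin q ⊕ Fin p) ℝ).val *ᵥ k.1) = k.1 := by
      rw [Matrix.mulVec_mulVec, ← Units.val_mul, inv_mul_cancel, Units.val_one,
        Matrix.one_mulVec]
    rw [← h2, h, Matrix.mulVec_zero]⟩

/-- The action `(T(g) F)(k) = F(g⁻¹ k)` on functions on the cone. -/
def T {p q : ℕ} (g : SO₀ p q) (F : Cone p q → ℂ) : Cone p q → ℂ :=
  fun k => F (Cone.act g⁻¹ k)

/-- The radial coordinate `ω = (k₁² + … + k_q²)^{1/2}` of a point of the cone. -/
def Cone.omega {p q : ℕ} (k : Cone p q) : ℝ := Real.sqrt (∑ i, k.1 (Sum.inl i) ^ 2)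

/-! ### The scalar product and the zonal function -/

/-- The unit sphere of `ℝⁿ`. -/
abbrev USphere (n : ℕ) : Type := Metric.sphere (0 : EuclideanSpace ℝ (Fin n)) 1

/-- The normalized surface measure on the unit sphere of `ℝⁿ`. -/
def sphereMeasure (n : ℕ) : Measure (USphere n) :=
  ((volume : Measure (EuclideanSpace ℝ (Fin n))).toSphere Set.univ)⁻¹ •
    (volume : Measure (EuclideanSpace ℝ (Fin n))).toSphere

/-- The point of the cross-section `ω = 1` of the cone that is given by two unit vectors. -/
def sectionPoint {p q : ℕ} (z : USphere q × USphere p) : Cone p q :=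
  ⟨Sum.elim (fun i => z.1.1 i) (fun j => z.2.1 j), by
    have h1 : ∑ i, z.1.1 i ^ 2 = 1 := by
      rw [← EuclideanSpace.real_norm_sq_eq, norm_eq_of_mem_sphere]; norm_num
    have h2 : ∑ i, z.2.1 i ^ 2 = 1 := by
      rw [← EuclideanSpace.real_norm_sq_eq, norm_eq_of_mem_sphere]; norm_num
    refine ⟨fun h => ?_, by simp [form, h1, h2]⟩
    have h3 : ∀ i, z.1.1 i = 0 := fun i => congrFun h (Sum.inl i)
    simp [h3] at h1⟩

/-- The scalar product of the restrictions of two functions to the cross-section `ω = 1`. -/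
def scalarProduct {p q : ℕ} (F₁ F₂ : Cone p q → ℂ) : ℂ :=
  ∫ z, F₁ (sectionPoint z) * (starRingEnd ℂ) (F₂ (sectionPoint z))
    ∂((sphereMeasure q).prod (sphereMeasure p))

/-- The normalized vector of `D^{(σ,0)}` that is invariant under `SO(p) × SO(q)`: the function
which is homogeneous of degree `σ` and equal to `1` on the cross-section `ω = 1`. -/
def invariantVector (p q : ℕ) (σ : ℂ) : Cone p q → ℂ := fun k => (k.omega : ℂ) ^ σ

/-- The matrix of the hyperbolic rotation through `α` in the plane `(k₁, k_{p+q})`: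
`k₁ ↦ k₁ cosh α + k_{p+q} sinh α`, `k_{p+q} ↦ k₁ sinh α + k_{p+q} cosh α`. -/
def hypMatrix (p q : ℕ) [NeZero p] [NeZero q] (α : ℝ) :
    Matrix (Fin q ⊕ Fin p) (Fin q ⊕ Fin p) ℝ :=
  let a : Fin q ⊕ Fin p := Sum.inl 0
  let b : Fin q ⊕ Fin p := Sum.inr (Fin.rev 0)
  1 + (Real.cosh α - 1) • (Matrix.single a a 1 + Matrix.single b b 1)
    + Real.sinh α • (Matrix.single a b 1 + Matrix.single b a 1)

theorem hypMatrix_zero (p q : ℕ) [NeZero p] [NeZero q] : hypMatrix p q 0 = 1 := by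
  simp [hypMatrix]

theorem hypMatrix_mulVec (p q : ℕ) [NeZero p] [NeZero q] (α : ℝ) (k : Fin q ⊕ Fin p → ℝ) :
    hypMatrix p q α *ᵥ k = Function.update (Function.update k
      (Sum.inl 0) (k (Sum.inl 0) * Real.cosh α + k (Sum.inr (Fin.rev 0)) * Real.sinh α))
      (Sum.inr (Fin.rev 0))
        (k (Sum.inl 0) * Real.sinh α + k (Sum.inr (Fin.rev 0)) * Real.cosh α) := by
  ext c
  simp only [hypMatrix, Matrix.add_mulVec, Matrix.smul_mulVec, Matrix.one_mulVec,
    Matrix.single_mulVec, Pi.add_apply, Pi.smul_apply, smul_eq_mul, Function.update_apply,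
    Pi.zero_apply, one_mul]
  by_cases h1 : c = Sum.inl 0
  · subst h1; simp; ring
  · by_cases h2 : c = Sum.inr (Fin.rev 0)
    · subst h2; simp; ring
    · simp [h1, h2]

theorem hypMatrix_mul (p q : ℕ) [NeZero p] [NeZero q] (α β : ℝ) :
    hypMatrix p q α * hypMatrix p q β = hypMatrix p q (α + β) := by
  apply Matrix.ext_of_mulVec_single
  intro c
  rw [← Matrix.mulVec_mulVec]
  generalize (Pi.single c (1 : ℝ) : Fin q ⊕ Fin p → ℝ) = k
  simp only [hypMatrix_mulVec, Real.cosh_add, Real.sinh_add]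
  ext c
  by_cases h1 : c = Sum.inl 0
  · subst h1; simp; ring
  · by_cases h2 : c = Sum.inr (Fin.rev 0)
    · subst h2; simp; ring
    · simp [h1, h2]

theorem form_hypMatrix (p q : ℕ) [NeZero p] [NeZero q] (α : ℝ) (k : Fin q ⊕ Fin p → ℝ) :
    form p q (hypMatrix p q α *ᵥ k) = form p q k := by
  rw [hypMatrix_mulVec]
  have hs := Real.cosh_sq α
  simp only [form]
  rw [← Finset.add_sum_erase _ _ (Finset.mem_univ (0 : Fin q)),
    ← Finset.add_sum_erase _ (fun i => k (Sum.inl i) ^ 2) (Finset.mem_univ (0 : Fin q)),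
    ← Finset.add_sum_erase _ _ (Finset.mem_univ (Fin.rev 0 : Fin p)),
    ← Finset.add_sum_erase _ (fun i => k (Sum.inr i) ^ 2) (Finset.mem_univ (Fin.rev 0 : Fin p))]
  have e1 : ∀ (u v : ℝ), ∑ x ∈ Finset.univ.erase (0 : Fin q), (Function.update (Function.update k
      (Sum.inl 0) u) (Sum.inr (Fin.rev 0)) v (Sum.inl x)) ^ 2 =
      ∑ x ∈ Finset.univ.erase (0 : Fin q), k (Sum.inl x) ^ 2 := fun u v =>
    Finset.sum_congr rfl fun x hx => by simp [Finset.ne_of_mem_erase hx]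
  have e2 : ∀ (u v : ℝ), ∑ x ∈ Finset.univ.erase (Fin.rev 0 : Fin p),
      (Function.update (Function.update k
      (Sum.inl 0) u) (Sum.inr (Fin.rev 0)) v (Sum.inr x)) ^ 2 =
      ∑ x ∈ Finset.univ.erase (Fin.rev 0 : Fin p), k (Sum.inr x) ^ 2 := fun u v =>
    Finset.sum_congr rfl fun x hx => by simp [Finset.ne_of_mem_erase hx]
  rw [e1, e2]
  simp
  linear_combination (k (Sum.inl 0) ^ 2 - k (Sum.inr (Fin.rev 0)) ^ 2) * hs

/-- The hyperbolic rotation as a motion. -/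
def hypMotion (p q : ℕ) [NeZero p] [NeZero q] (α : ℝ) : motionGroup p q :=
  ⟨⟨hypMatrix p q α, hypMatrix p q (-α),
    by rw [hypMatrix_mul, add_neg_cancel, hypMatrix_zero],
    by rw [hypMatrix_mul, neg_add_cancel, hypMatrix_zero]⟩, form_hypMatrix p q α⟩

theorem hypMotion_mem (p q : ℕ) [NeZero p] [NeZero q] (α : ℝ) : hypMotion p q α ∈ SO₀ p q := by
  have hc : Continuous (hypMotion p q) := by
    refine Continuous.subtype_mk (Units.continuous_iff.2 ⟨?_, ?_⟩) _
    · change Continuous fun α => hypMatrix p q α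
      unfold hypMatrix
      fun_prop
    · change Continuous fun α => hypMatrix p q (-α)
      unfold hypMatrix
      fun_prop
  have h0 : hypMotion p q 0 = 1 := by
    ext1; ext1; exact hypMatrix_zero p q
  have h := (isPreconnected_range hc).subset_connectedComponent (Set.mem_range_self 0)
    (Set.mem_range_self α)
  rw [h0] at h
  exact h

/-- The hyperbolic rotation through `α` in the plane `(k₁, k_{p+q})` as an element
of `SO₀(p,q)`. -/
def hypRotation (p q : ℕ) [NeZero p] [NeZero q] (α : ℝ) : SO₀ p q :=
  ⟨hypMotion p q α, hypMotion_mem p q α⟩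

/-- The zonal spherical function `Z_σ^{[p,q]}(α)`: the matrix element of the hyperbolic rotation
with respect to the normalized `SO(p) × SO(q)`-invariant vector. -/
def Z (p q : ℕ) [NeZero p] [NeZero q] (σ : ℂ) (α : ℝ) : ℂ :=
  scalarProduct (T (hypRotation p q α) (invariantVector p q σ)) (invariantVector p q σ)

/-! ### Hypergeometric functions -/

/-- Pochhammer's symbol `(a)_n = a (a+1) ⋯ (a+n-1)`. -/
def poch (a : ℂ) (n : ℕ) : ℂ := (ascPochhammer ℂ n).eval a

/-- Appell's function of the second kind. If `b` and `b'` are nonpositive integers, only finitely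
many terms of the series differ from `0`. -/
def appellF₂ (a b b' c c' x y : ℂ) : ℂ :=
  ∑' mn : ℕ × ℕ, poch a (mn.1 + mn.2) * poch b mn.1 * poch b' mn.2 /
    (poch c mn.1 * poch c' mn.2 * (mn.1.factorial : ℂ) * (mn.2.factorial : ℂ)) *
      x ^ mn.1 * y ^ mn.2

/-- The generalized hypergeometric function `₃F₂(a, b, c; d, e; x)`. If `b = -l` for a natural
number `l`, the terms with index greater than `l` are `0`. -/
def hyp₃F₂ (a b c d e x : ℂ) : ℂ :=
  ∑' n : ℕ, poch a n * poch b n * poch c n / (poch d n * poch e n * (n.factorial : ℂ)) * x ^ n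

/-- `((1/2)_l / l!) F₂(-σ/2, -l, -l; p/2, q/2; 1, 1)`. -/
def appellCoeff (p q : ℕ) (σ : ℂ) (l : ℕ) : ℂ :=
  poch (1 / 2) l / (l.factorial : ℂ) *
    appellF₂ (-σ / 2) (-(l : ℂ)) (-(l : ℂ)) ((p : ℂ) / 2) ((q : ℂ) / 2) 1 1

/-- The coefficients of the second series for `SO(3,2)`. -/
def coeff₃₂ (σ : ℂ) (l : ℕ) : ℂ :=
  poch (1 / 2) l * poch ((3 + σ) / 2) l * poch (σ / 2 + 1) l /
      (poch (3 / 2) l * (l.factorial : ℂ) ^ 2) *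
    hyp₃F₂ (-σ / 2) (-(l : ℂ)) (-(l : ℂ)) (-(σ + 1) / 2 - l) (-σ / 2 - l) 1

/-- The coefficients of the second series for `SO(4,2)`. -/
def coeff₄₂ (σ : ℂ) (l : ℕ) : ℂ :=
  poch (1 / 2) l * poch (σ / 2 + 2) l * poch (σ / 2 + 1) l /
      ((l.factorial : ℂ) ^ 2 * Complex.Gamma (l + 2)) *
    hyp₃F₂ (-σ / 2) (-(l : ℂ)) (-(l : ℂ)) (-σ / 2 - l - 1) (-σ / 2 - l) 1

end ZonalSO

end

namespace ZonalSO

/-! ### Pochhammer symbols -/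

/-! On the section let `x` be the first coordinate of the point of `S^{q-1}` and `y` the last
coordinate of the point of `S^{p-1}`. The invariant vector is 1 on the section, so `Z` is the
integral of `ω^σ`, where `ω² = 1 + sinh²α (x² + y²) - 2 cosh α sinh α xy`. For all `p, q` the series
of Appell functions is obtained first at `σ = 2N` and then at every `σ` by polynomial interpolation
of the coefficients.

For `σ = 2N`, `ω^{2N} = (1 + (ω² - 1))^N` is a polynomial in `x` and `y`, integrated by the moments
of sphere coordinates (`integral_sphere_pow`, `integral_pow_omegaSq_sub_one`). The generating
function of `C(l,m) C(l,n)` with weight `(1/2)_l / l!` (`hasSum_mehler_even`) turns the result into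
a series in `tanh²α`, whose coefficients are the finite sums `F₂(-N,-l,-l; p/2,q/2; 1,1)`.

For general `σ`, put `τ = tanh α`, `x = cos θ`, `y = cos φ`. Then `ω² = cosh²α (1 - τ cos(θ-φ)) (1 -
τ cos(θ+φ))` (`cosh_mul_sqrt_omegaSq_cpow`). Binomial series expand `cosh α · Z` in powers of `τ`,
uniformly on the section for fixed `|τ| < 1`, with coefficients polynomial in `σ`. The Appell
coefficients are polynomial in `σ` as well. Both agree at all even naturals, hence everywhere
(`hasSum_appellCoeff`).

The `₃F₂` forms are algebra: two Chu–Vandermonde summations bring `F₂` at unit argument to a sum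
symmetric in `c` and `c'`, and the terminating `₃F₂` is the same sum with reversed Pochhammer
symbols. The equality holds wherever the `₃F₂` are defined. Elsewhere, continuity of the polynomial
Appell coefficients gives the limits.

For `SO(4,1)`, `S⁰` has `x² = 1`, so `ω²` is a perfect square and a single binomial series suffices.
-/

@[simp] theorem poch_zero (a : ℂ) : poch a 0 = 1 := by simp [poch]

theorem poch_succ (a : ℂ) (n : ℕ) : poch a (n + 1) = poch a n * (a + n) := by
  simp [poch, ascPochhammer_succ_eval]

theorem poch_add (a : ℂ) (m n : ℕ) : poch a (m + n) = poch a m * poch (a + m) n := by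
  induction n with
  | zero => simp
  | succ n ih => rw [← add_assoc, poch_succ, poch_succ, ih]; push_cast; ring

theorem poch_ne_zero {a : ℂ} {n : ℕ} (h : ∀ k < n, a + k ≠ 0) : poch a n ≠ 0 := by
  induction n with
  | zero => simp
  | succ n ih =>
    rw [poch_succ]
    exact mul_ne_zero (ih fun k hk => h k (by omega)) (h n (by omega))

theorem poch_ne_zero_of_re_pos {a : ℂ} (ha : 0 < a.re) (n : ℕ) : poch a n ≠ 0 := by
  refine poch_ne_zero fun k _ h => ?_
  have := congrArg Complex.re h
  simp at this
  linarith [(Nat.cast_nonneg k : (0 : ℝ) ≤ k)]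

theorem poch_neg_natCast (l n : ℕ) :
    poch (-(l : ℂ)) n = (-1) ^ n * (n.factorial : ℂ) * (l.choose n : ℂ) := by
  induction n with
  | zero => simp
  | succ n ih =>
    rw [poch_succ, ih]
    have h : ((l.choose (n + 1) * (n + 1) : ℕ) : ℂ) = l.choose n * ((l : ℂ) - n) := by
      rw [Nat.choose_succ_right_eq]
      rcases le_or_gt n l with h | h
      · push_cast [h]; ring
      · simp [Nat.choose_eq_zero_of_lt h]
    push_cast [Nat.factorial_succ] at h ⊢
    linear_combination (-1) ^ n * (-1) * (n.factorial : ℂ) * (-h)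

theorem poch_reflect (b : ℂ) (j : ℕ) : poch (1 - b - j) j = (-1) ^ j * poch b j := by
  induction j generalizing b with
  | zero => simp
  | succ n ih =>
    rw [add_comm n 1, poch_add, show (1 + n) = n + 1 by ring, poch_succ b]
    have h := ih b
    rw [show (1 : ℂ) - b - ((n + 1 : ℕ) : ℂ) + ((1 : ℕ) : ℂ) = 1 - b - n by push_cast; ring, h,
      poch_succ]
    push_cast; simp; ring

theorem choose_neg_eq_poch (a : ℂ) (n : ℕ) :
    Ring.choose (-a) n = (-1) ^ n * (poch a n / n.factorial) := by
  have hf : (n.factorial : ℂ) ≠ 0 := by exact_mod_cast n.factorial_ne_zero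
  have h := Ring.descPochhammer_eq_factorial_smul_choose (-a) n
  rw [Polynomial.descPochhammer_smeval_eq_ascPochhammer] at h
  rw [Polynomial.ascPochhammer_smeval_eq_eval] at h
  have h2 : Polynomial.eval (-a - (n : ℂ) + 1) (ascPochhammer ℂ n) = (-1) ^ n * poch a n := by
    rw [← poch_reflect, poch]; congr 1; ring
  rw [h2, nsmul_eq_mul] at h
  field_simp
  linear_combination -h

/-- Chu–Vandermonde: the addition formula for binomial coefficients with upper arguments `-x` and
`-y`. -/
theorem poch_vandermonde (x y : ℂ) (l : ℕ) :
    ∑ ij ∈ Finset.HasAntidiagonal.antidiagonal l, (l.choose ij.1 : ℂ) * poch x ij.1 * poch y ij.2 =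
      poch (x + y) l := by
  have h := Ring.add_choose_eq (R := ℂ) l (Commute.all (-x) (-y))
  rw [← neg_add, choose_neg_eq_poch] at h
  have hf : (l.factorial : ℂ) ≠ 0 := by exact_mod_cast l.factorial_ne_zero
  have h2 : poch (x + y) l = (l.factorial : ℂ) * (-1) ^ l * ((-1) ^ l * (poch (x + y) l /
      l.factorial)) := by
    have : ((-1 : ℂ) ^ l) * (-1) ^ l = 1 := by rw [← mul_pow]; simp
    field_simp
    linear_combination -poch (x + y) l * this
  rw [h2, h, Finset.mul_sum]
  refine Finset.sum_congr rfl fun ij hij => ?_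
  obtain ⟨i, j⟩ := ij
  obtain rfl : i + j = l := by simpa using hij
  have h3 : (((i + j).choose i * i.factorial * j.factorial : ℕ) : ℂ) = (i + j).factorial := by
    rw [Nat.choose_symm_add, Nat.add_choose_mul_factorial_mul_factorial]
  have hi : (i.factorial : ℂ) ≠ 0 := by exact_mod_cast i.factorial_ne_zero
  have hj : (j.factorial : ℂ) ≠ 0 := by exact_mod_cast j.factorial_ne_zero
  have h4 : ((-1 : ℂ) ^ (i + j)) * ((-1) ^ i * (-1) ^ j) = 1 := by
    rw [← pow_add, ← mul_pow]; simp
  simp only [choose_neg_eq_poch]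
  rw [← h3]
  push_cast
  field_simp
  linear_combination -((i + j).choose i : ℂ) * poch x i * poch y j * h4

/-- Gauss's sum for `₂F₁(a,-l;b;1)` with denominators cleared, so no condition on `b` is needed. It
is Vandermonde at `y = 1 - b - l`, each factor reversed by `poch_reflect`. -/
theorem poch_vandermonde_alternating (a b : ℂ) (l : ℕ) :
    ∑ ij ∈ Finset.HasAntidiagonal.antidiagonal l,
      (-1) ^ ij.1 * (l.choose ij.1 : ℂ) * poch a ij.1 * poch (b + ij.1) ij.2 =
      poch (b - a) l := by
  have h := poch_vandermonde a (1 - b - l) l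
  rw [show a + (1 - b - l) = 1 - (b - a) - l by ring, poch_reflect] at h
  have h1 : ((-1 : ℂ) ^ l) * (-1) ^ l = 1 := by rw [← mul_pow]; simp
  have h2 : poch (b - a) l = (-1) ^ l * ((-1) ^ l * poch (b - a) l) := by
    rw [← mul_assoc, h1, one_mul]
  rw [h2, ← h, Finset.mul_sum]
  refine Finset.sum_congr rfl fun ij hij => ?_
  obtain ⟨i, j⟩ := ij
  obtain rfl : i + j = l := by simpa using hij
  have h3 := poch_reflect (b + i) j
  rw [show (1 : ℂ) - (b + i) - j = 1 - b - ((i + j : ℕ) : ℂ) by push_cast; ring] at h3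
  dsimp only at h3 ⊢
  rw [h3]
  have h4 : ((-1 : ℂ) ^ j) * (-1) ^ j = 1 := by rw [← mul_pow]; simp
  rw [pow_add]
  linear_combination (-(-1) ^ i * ((i + j).choose i : ℂ) * poch a i * poch (b + i) j) * h4

/-! ### Appell's function at unit argument -/

theorem appellF₂_eq_sum (a c c' : ℂ) (l : ℕ) :
    appellF₂ a (-(l : ℂ)) (-(l : ℂ)) c c' 1 1 =
      ∑ m ∈ Finset.range (l + 1), ∑ n ∈ Finset.range (l + 1),
        (-1) ^ (m + n) * poch a (m + n) * (l.choose m : ℂ) * (l.choose n : ℂ) /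
          (poch c m * poch c' n) := by
  rw [appellF₂, tsum_eq_sum (s := Finset.range (l + 1) ×ˢ Finset.range (l + 1)),
    Finset.sum_product]
  · refine Finset.sum_congr rfl fun m _ => Finset.sum_congr rfl fun n _ => ?_
    have hm : (m.factorial : ℂ) ≠ 0 := by exact_mod_cast m.factorial_ne_zero
    have hn : (n.factorial : ℂ) ≠ 0 := by exact_mod_cast n.factorial_ne_zero
    simp only [poch_neg_natCast, one_pow, mul_one, pow_add]
    rw [← mul_div_mul_right _ (poch c m * poch c' n) (mul_ne_zero hm hn)]
    congr 1 <;> ring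
  · rintro ⟨m, n⟩ h
    simp only [Finset.mem_product, Finset.mem_range, not_and_or, not_lt] at h
    rcases h with h | h <;> simp [poch_neg_natCast, Nat.choose_eq_zero_of_lt h]

/-- The symmetric numerator of Appell's `F₂(a,-l,-l;c,c';1,1)`. -/
noncomputable def appellNumerator (a c c' : ℂ) (l : ℕ) : ℂ :=
  ∑ ij ∈ Finset.HasAntidiagonal.antidiagonal l, (l.choose ij.1 : ℂ) * poch (c' - a) ij.2 *
    (poch a ij.1 * (l.descFactorial ij.1 : ℂ)) * poch (c - a) ij.2

theorem sum_alternating_poch_div (a c : ℂ) (l : ℕ) (hc : poch c l ≠ 0) :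
    ∑ n ∈ Finset.range (l + 1), (-1) ^ n * (l.choose n : ℂ) * poch a n / poch c n =
      poch (c - a) l / poch c l := by
  rw [eq_div_iff hc, ← poch_vandermonde_alternating,
    Finset.Nat.sum_antidiagonal_eq_sum_range_succ_mk, Finset.sum_mul]
  refine Finset.sum_congr rfl fun n hn => ?_
  have hn' : n ≤ l := by simpa [Nat.lt_succ_iff] using hn
  have h : poch c l = poch c n * poch (c + n) (l - n) := by
    rw [← poch_add, Nat.add_sub_cancel' hn']
  have h0 : poch c n ≠ 0 := fun h0 => hc (by rw [h, h0, zero_mul])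
  rw [h]
  field_simp

/-- The factor `(-m)_k` vanishes for `m < k`. Putting `m = k + i`, the binomials regroup and what
remains is the alternating Vandermonde sum with `a` and `c` both shifted by `k`. -/
theorem sum_choose_alternating_shifted (a c : ℂ) (k j : ℕ) :
    ∑ m ∈ Finset.range (k + j + 1), (-1) ^ m * ((k + j).choose m : ℂ) * poch a m *
        poch (c + m) (k + j - m) * poch (-(m : ℂ)) k =
      poch a k * ((k + j).descFactorial k : ℂ) * poch (c - a) j := by
  have h := poch_vandermonde_alternating (a + k) (c + k) j
  rw [show c + k - (a + k) = c - a by ring,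
    Finset.Nat.sum_antidiagonal_eq_sum_range_succ_mk] at h
  rw [← h, add_assoc, Finset.sum_range_add, Finset.sum_eq_zero, zero_add, Finset.mul_sum]
  · refine Finset.sum_congr rfl fun i hi => ?_
    have hi' : i ≤ j := by simpa [Nat.lt_succ_iff] using hi
    have e1 : k + j - (k + i) = j - i := by omega
    have e2 : (((k + j).choose (k + i) * (k + i).descFactorial k : ℕ) : ℂ) =
        ((k + j).descFactorial k * j.choose i : ℕ) := by
      congr 1
      rw [Nat.descFactorial_eq_factorial_mul_choose, Nat.descFactorial_eq_factorial_mul_choose]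
      have := Nat.choose_mul (n := k + j) (k := k + i) (s := k)
        (by omega)
      rw [show k + j - k = j by omega, show k + i - k = i by omega] at this
      linear_combination k.factorial * this
    have e3 : poch (-((k + i : ℕ) : ℂ)) k = (-1) ^ k * ((k + i).descFactorial k : ℂ) := by
      rw [poch_neg_natCast, Nat.descFactorial_eq_factorial_mul_choose]; push_cast; ring
    have e4 : ((-1 : ℂ) ^ k) * (-1) ^ k = 1 := by rw [← mul_pow]; simp
    rw [e1, e3, poch_add a k i, pow_add]
    push_cast at e2 ⊢
    rw [show c + (↑k + ↑i) = c + ↑k + ↑i by ring]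
    linear_combination ((-1) ^ i * poch a k * poch (a + k) i * poch (c + k + i) (j - i)) *
      (((-1) ^ k * (-1) ^ k) * e2 + ((k + j).descFactorial k : ℂ) * (j.choose i : ℂ) * e4)
  · intro m hm
    rw [Finset.mem_range] at hm
    simp [poch_neg_natCast, Nat.choose_eq_zero_of_lt hm]

/-- Gauss's sum over `n` leaves `(c'-a-m)_l / (c')_l`. Splitting its argument as `-m + (c'-a)` by
Vandermonde makes the sum over `m` one of the shifted sums above. -/
theorem appellF₂_eq_appellNumerator_div (a c c' : ℂ) (l : ℕ) (hc : poch c l ≠ 0)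
    (hc' : poch c' l ≠ 0) :
    appellF₂ a (-(l : ℂ)) (-(l : ℂ)) c c' 1 1 =
      appellNumerator a c c' l / (poch c l * poch c' l) := by
  have h1 : appellF₂ a (-(l : ℂ)) (-(l : ℂ)) c c' 1 1 =
      ∑ m ∈ Finset.range (l + 1), (-1) ^ m * (l.choose m : ℂ) * poch a m / poch c m *
        (poch (c' - a - m) l / poch c' l) := by
    rw [appellF₂_eq_sum]
    refine Finset.sum_congr rfl fun m _ => ?_
    rw [show c' - a - m = c' - (a + m) by ring, ← sum_alternating_poch_div _ _ _ hc',
      Finset.mul_sum]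
    refine Finset.sum_congr rfl fun n _ => ?_
    rw [poch_add, pow_add, div_mul_div_comm]
    congr 1; ring
  rw [h1, eq_div_iff (mul_ne_zero hc hc'), Finset.sum_mul, appellNumerator]
  have h2 : ∀ m ∈ Finset.range (l + 1), (-1) ^ m * (l.choose m : ℂ) * poch a m / poch c m *
      (poch (c' - a - m) l / poch c' l) * (poch c l * poch c' l) =
      ∑ ij ∈ Finset.HasAntidiagonal.antidiagonal l, (l.choose ij.1 : ℂ) * poch (c' - a) ij.2 *
        ((-1) ^ m * (l.choose m : ℂ) * poch a m * poch (c + m) (l - m) *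
          poch (-(m : ℂ)) ij.1) := by
    intro m hm
    have hm' : m ≤ l := by simpa [Nat.lt_succ_iff] using hm
    have h : poch c l = poch c m * poch (c + m) (l - m) := by
      rw [← poch_add, Nat.add_sub_cancel' hm']
    have h0 : poch c m ≠ 0 := fun h0 => hc (by rw [h, h0, zero_mul])
    rw [show c' - a - m = -(m : ℂ) + (c' - a) by ring, ← poch_vandermonde, h]
    rw [show ∀ x y : ℂ, x / poch c m * (y / poch c' l) * (poch c m * poch (c + m) (l - m) *
      poch c' l) = x * poch (c + m) (l - m) * y from fun x y => by field_simp, Finset.mul_sum]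
    exact Finset.sum_congr rfl fun ij _ => by ring
  rw [Finset.sum_congr rfl h2, Finset.sum_comm]
  refine Finset.sum_congr rfl fun ij hij => ?_
  obtain ⟨k, j⟩ := ij
  obtain rfl : k + j = l := by simpa using hij
  rw [← Finset.mul_sum, sum_choose_alternating_shifted]
  ring

/-! ### The terminating `₃F₂` at unit argument -/

theorem poch_div_poch_reflect (b : ℂ) (l n : ℕ) (hn : n ≤ l) (h : poch (1 - b - l) n ≠ 0) :
    poch b l / poch (1 - b - l) n = (-1) ^ n * poch b (l - n) := by
  have h1 : poch b l = poch b (l - n) * poch (b + (l - n : ℕ)) n := by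
    rw [← poch_add, Nat.sub_add_cancel hn]
  have h2 := poch_reflect (b + (l - n : ℕ)) n
  rw [show 1 - (b + ((l - n : ℕ) : ℂ)) - n = 1 - b - l by push_cast [hn]; ring] at h2
  have h4 : ((-1 : ℂ) ^ n) * (-1) ^ n = 1 := by rw [← mul_pow]; simp
  rw [div_eq_iff h, h2, h1]
  linear_combination -(poch b (l - n) * poch (b + (l - n : ℕ)) n) * h4

/-- The lower parameters are the reflections of `c - a` and `c' - a`, so the prefactor cancels both
denominators and leaves the terms of the Appell numerator. -/
theorem mul_hyp₃F₂_eq_appellNumerator (a c c' d e : ℂ) (l : ℕ) (hd : d = 1 - (c - a) - l)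
    (he : e = 1 - (c' - a) - l) (hd0 : poch d l ≠ 0) (he0 : poch e l ≠ 0) :
    poch (c - a) l * poch (c' - a) l * hyp₃F₂ a (-(l : ℂ)) (-(l : ℂ)) d e 1 =
      appellNumerator a c c' l := by
  rw [hyp₃F₂, tsum_eq_sum (s := Finset.range (l + 1)), appellNumerator,
    Finset.Nat.sum_antidiagonal_eq_sum_range_succ_mk, Finset.mul_sum]
  · refine Finset.sum_congr rfl fun n hn => ?_
    have hn' : n ≤ l := by simpa [Nat.lt_succ_iff] using hn
    have key : ∀ x : ℂ, poch x l ≠ 0 → poch x n ≠ 0 := fun x hx h0 => hx (by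
      rw [← Nat.add_sub_cancel' hn', poch_add, h0, zero_mul])
    have h1 := poch_div_poch_reflect (c - a) l n hn' (by rw [← hd]; exact key _ hd0)
    have h2 := poch_div_poch_reflect (c' - a) l n hn' (by rw [← he]; exact key _ he0)
    rw [← hd] at h1
    rw [← he] at h2
    have hf : (n.factorial : ℂ) ≠ 0 := by exact_mod_cast n.factorial_ne_zero
    have h4 : ((-1 : ℂ) ^ n) * (-1) ^ n = 1 := by rw [← mul_pow]; simp
    rw [poch_neg_natCast, Nat.descFactorial_eq_factorial_mul_choose]
    rw [show ∀ x y u v w : ℂ, x * y * (w / (u * v * (n.factorial : ℂ)) * 1 ^ n) =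
      (x / u) * (y / v) * (w / n.factorial) from fun x y u v w => by
        rw [one_pow, mul_one]; simp only [div_eq_mul_inv, mul_inv]; ring, h1, h2]
    push_cast
    field_simp
    -- Four signs `(-1)^n` occur, two from the reflections and two from `(-l)_n²`; the factor comes
    -- from `X² - 1 = (X + 1)(X - 1)`.
    linear_combination ((l.choose n : ℂ) ^ 2 * poch a n *
      poch (c - a) (l - n) * poch (c' - a) (l - n)) * ((-1) ^ n * (-1) ^ n + 1) * h4
  · intro n hn
    simp only [Finset.mem_range, not_lt] at hn
    simp [poch_neg_natCast, Nat.choose_eq_zero_of_lt hn]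

theorem coeff₃₂_eq_appellCoeff {σ : ℂ} (h : ∀ n : ℕ, σ ≠ -((n : ℂ) + 2)) (l : ℕ) :
    coeff₃₂ σ l = appellCoeff 3 2 σ l := by
  have h32 : poch (3 / 2) l ≠ 0 := poch_ne_zero_of_re_pos (by norm_num) l
  have h1 : poch 1 l ≠ 0 := poch_ne_zero_of_re_pos (by norm_num) l
  have h1' : poch 1 l = l.factorial := by simp [poch]
  -- A vanishing factor with index `k < l` would force `σ = -(2(l-1-k) + 3)`, an odd excluded value.
  -- The other lower parameter gives the even ones.
  have hd : poch (-(σ + 1) / 2 - l) l ≠ 0 := poch_ne_zero fun k hk h0 => by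
    refine h (2 * (l - 1 - k) + 1) ?_
    have : k + 1 ≤ l := hk
    rw [show l - 1 - k = l - (k + 1) by omega]
    push_cast [this]
    linear_combination -2 * h0
  have he : poch (-σ / 2 - l) l ≠ 0 := poch_ne_zero fun k hk h0 => by
    refine h (2 * (l - 1 - k)) ?_
    have : k + 1 ≤ l := hk
    rw [show l - 1 - k = l - (k + 1) by omega]
    push_cast [this]
    linear_combination -2 * h0
  have hm := mul_hyp₃F₂_eq_appellNumerator (-σ / 2) (3 / 2) 1 _ _ l (by ring) (by ring) hd he
  rw [coeff₃₂, appellCoeff]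
  rw [show ((3 : ℕ) : ℂ) / 2 = 3 / 2 by norm_num, show ((2 : ℕ) : ℂ) / 2 = 1 by norm_num,
    appellF₂_eq_appellNumerator_div _ _ _ _ h32 h1, ← hm,
    show (3 : ℂ) / 2 - -σ / 2 = (3 + σ) / 2 by ring, show (1 : ℂ) - -σ / 2 = σ / 2 + 1 by ring,
    h1']
  have hf : (l.factorial : ℂ) ≠ 0 := by exact_mod_cast l.factorial_ne_zero
  field_simp

theorem coeff₄₂_eq_appellCoeff {σ : ℂ} (h : ∀ n : ℕ, σ ≠ -(2 * (n : ℂ) + 2)) (l : ℕ) :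
    coeff₄₂ σ l = appellCoeff 4 2 σ l := by
  have h32 : poch 2 l ≠ 0 := poch_ne_zero_of_re_pos (by norm_num) l
  have h1 : poch 1 l ≠ 0 := poch_ne_zero_of_re_pos (by norm_num) l
  have h1' : poch 1 l = l.factorial := by simp [poch]
  have h2' : Complex.Gamma (l + 2) = poch 2 l := by
    have h3 := poch_add 1 1 l
    have h4 : poch 1 (1 + l) = (1 + l).factorial := by simp [poch]
    rw [h4] at h3
    rw [show (l : ℂ) + 2 = ((1 + l : ℕ) : ℂ) + 1 by push_cast; ring, Complex.Gamma_nat_eq_factorial,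
      h3]
    norm_num [poch_succ]
  -- Here both lower parameters differ from `-σ/2` by an integer, so only even values of `σ` are
  -- excluded.
  have hd : poch (-σ / 2 - l - 1) l ≠ 0 := poch_ne_zero fun k hk h0 => by
    refine h (l - 1 - k + 1) ?_
    have : k + 1 ≤ l := hk
    rw [show l - 1 - k = l - (k + 1) by omega]
    push_cast [this]
    linear_combination -2 * h0
  have he : poch (-σ / 2 - l) l ≠ 0 := poch_ne_zero fun k hk h0 => by
    refine h (l - 1 - k) ?_
    have : k + 1 ≤ l := hk
    rw [show l - 1 - k = l - (k + 1) by omega]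
    push_cast [this]
    linear_combination -2 * h0
  have hm := mul_hyp₃F₂_eq_appellNumerator (-σ / 2) 2 1 _ _ l (by ring) (by ring) hd he
  rw [coeff₄₂, appellCoeff]
  rw [show ((4 : ℕ) : ℂ) / 2 = 2 by norm_num, show ((2 : ℕ) : ℂ) / 2 = 1 by norm_num,
    appellF₂_eq_appellNumerator_div _ _ _ _ h32 h1, ← hm,
    show (2 : ℂ) - -σ / 2 = σ / 2 + 2 by ring, show (1 : ℂ) - -σ / 2 = σ / 2 + 1 by ring,
    h1', h2']
  have hf : (l.factorial : ℂ) ≠ 0 := by exact_mod_cast l.factorial_ne_zero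
  field_simp

/-! ### Binomial series -/

theorem summable_norm_poch_series (b z : ℂ) (hz : ‖z‖ < 1) :
    Summable fun n : ℕ => ‖poch b n / n.factorial * z ^ n‖ := by
  have h := Complex.one_add_cpow_hasFPowerSeriesOnBall_zero (a := -b)
  have hz' : -z ∈ Metric.eball (0 : ℂ) (binomialSeries ℂ (-b)).radius := by
    refine Metric.eball_subset_eball h.r_le ?_
    rw [← ENNReal.ofReal_one, Metric.eball_ofReal]
    simpa using hz
  refine ((binomialSeries ℂ (-b)).summable_norm_apply hz').congr fun n => ?_
  rw [binomialSeries_apply, choose_neg_eq_poch]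
  simp

theorem hasSum_poch_series (b z : ℂ) (hz : ‖z‖ < 1) :
    HasSum (fun n : ℕ => poch b n / n.factorial * z ^ n) ((1 - z) ^ (-b)) := by
  have h := Complex.one_add_cpow_hasFPowerSeriesOnBall_zero (a := -b)
  have hz' : -z ∈ Metric.eball (0 : ℂ) 1 := by
    rw [← ENNReal.ofReal_one, Metric.eball_ofReal]
    simpa using hz
  have h2 := h.hasSum hz'
  rw [zero_add, ← sub_eq_add_neg] at h2
  refine h2.congr_fun fun n => ?_
  rw [binomialSeries_apply, choose_neg_eq_poch]
  have h4 : ((-1 : ℂ) ^ n) * (-1) ^ n = 1 := by rw [← mul_pow]; simp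
  simp only [List.ofFn_const, List.prod_replicate, smul_eq_mul]
  rw [neg_pow z]
  linear_combination -(poch b n / n.factorial * z ^ n) * h4

theorem norm_tanh_lt_one (α : ℝ) : ‖(Real.tanh α : ℂ)‖ < 1 := by
  rw [Complex.norm_real, Real.norm_eq_abs]
  exact Real.abs_tanh_lt_one α

theorem one_sub_tanh_sq (α : ℝ) : 1 - Real.tanh α ^ 2 = (Real.cosh α ^ 2)⁻¹ := by
  have := (Real.cosh_pos α).ne'
  have h := Real.cosh_sq α
  rw [Real.tanh_eq_sinh_div_cosh]
  field_simp
  linarith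

theorem one_sub_tanh_sq_cpow (α : ℝ) (x : ℂ) :
    (1 - (Real.tanh α : ℂ) ^ 2) ^ x = (Real.cosh α : ℂ) ^ (-2 * x) := by
  have hc := Real.cosh_pos α
  have h : (1 - (Real.tanh α : ℂ) ^ 2) = ((Real.cosh α : ℂ)) ^ (-2 : ℂ) := by
    rw [Complex.cpow_neg, Complex.cpow_ofNat]
    exact_mod_cast one_sub_tanh_sq α
  rw [h, Complex.cpow_mul]
  · rw [← Complex.ofReal_log hc.le]
    simp [Real.pi_pos]
  · rw [← Complex.ofReal_log hc.le]
    simp [Real.pi_pos.le]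

/-- With `l = n + k` the terms form the binomial series of exponent `-(1/2 + k)` in `tanh²α`, times
`tanh^{2k} α`; then `1 - tanh² = cosh⁻²`. -/
theorem hasSum_poch_half_choose (α : ℝ) (k : ℕ) :
    HasSum (fun l : ℕ => poch (1 / 2) l / l.factorial * (l.choose k : ℂ) *
        ((Real.tanh α : ℂ) ^ 2) ^ l)
      (Real.cosh α * (poch (1 / 2) k / k.factorial) * ((Real.sinh α : ℂ) ^ 2) ^ k) := by
  have hc : (Real.cosh α : ℂ) ≠ 0 := by exact_mod_cast (Real.cosh_pos α).ne'
  have ht : ‖(Real.tanh α : ℂ) ^ 2‖ < 1 := by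
    rw [norm_pow]; exact pow_lt_one₀ (norm_nonneg _) (norm_tanh_lt_one α) two_ne_zero
  have h := (hasSum_poch_series (1 / 2 + k) _ ht).mul_left
    (poch (1 / 2) k / k.factorial * ((Real.tanh α : ℂ) ^ 2) ^ k)
  rw [one_sub_tanh_sq_cpow, show -2 * -((1 : ℂ) / 2 + k) = 1 + (2 * k : ℕ) by push_cast; ring,
    Complex.cpow_add _ _ hc, Complex.cpow_one, Complex.cpow_natCast] at h
  have hv : poch (1 / 2) k / k.factorial * ((Real.tanh α : ℂ) ^ 2) ^ k *
      (Real.cosh α * (Real.cosh α : ℂ) ^ (2 * k)) =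
      Real.cosh α * (poch (1 / 2) k / k.factorial) * ((Real.sinh α : ℂ) ^ 2) ^ k := by
    have : (Real.sinh α : ℂ) = Real.tanh α * Real.cosh α := by
      rw [Real.tanh_eq_sinh_div_cosh, Complex.ofReal_div, div_mul_cancel₀ _ hc]
    rw [this, pow_mul]; ring
  rw [hv] at h
  -- The terms with `l < k` vanish, so the summation index may be shifted by `k`.
  rw [← add_zero (Real.cosh α * (poch (1 / 2) k / k.factorial) * ((Real.sinh α : ℂ) ^ 2) ^ k),
    ← Finset.sum_eq_zero (s := Finset.range k) (f := fun l : ℕ => poch (1 / 2) l / l.factorial *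
      (l.choose k : ℂ) * ((Real.tanh α : ℂ) ^ 2) ^ l) (fun l hl => by
        simp [Nat.choose_eq_zero_of_lt (Finset.mem_range.1 hl)]), ← hasSum_nat_add_iff]
  refine h.congr_fun fun n => ?_
  have e : (((n + k).choose k * n.factorial * k.factorial : ℕ) : ℂ) = (n + k).factorial := by
    rw [Nat.add_choose_mul_factorial_mul_factorial]
  have hn : (n.factorial : ℂ) ≠ 0 := by exact_mod_cast n.factorial_ne_zero
  have hk : (k.factorial : ℂ) ≠ 0 := by exact_mod_cast k.factorial_ne_zero
  have hnk : ((n + k).factorial : ℂ) ≠ 0 := by exact_mod_cast (n + k).factorial_ne_zero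
  rw [add_comm n k, poch_add, add_comm k n, pow_add]
  push_cast at e
  generalize poch (1 / 2 + (k : ℂ)) n = P
  field_simp
  linear_combination (P * poch (1 / 2) k * ((Real.tanh α : ℂ) ^ (n * 2 + k * 2))) * e

/-! ### An even Mehler formula -/

/-- Pairs of an `m`-subset and an `n`-subset of `l` points, sorted by the size `ρ` of the
intersection: choose the union, the `m`-subset in it, then the intersection. This linearizes the
product in `C(l, ·)`. -/
theorem choose_mul_choose_eq_sum (l m n : ℕ) :
    l.choose m * l.choose n =
      ∑ ρ ∈ Finset.range (m + 1),
        m.choose ρ * (m + n - ρ).choose m * l.choose (m + n - ρ) := by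
  rcases lt_or_ge l m with h | h
  · rw [Nat.choose_eq_zero_of_lt h, zero_mul, eq_comm]
    refine Finset.sum_eq_zero fun ρ hρ => ?_
    rcases le_or_gt ρ n with h' | h'
    · rw [Nat.choose_eq_zero_of_lt (show l < m + n - ρ by omega), mul_zero]
    · rw [Finset.mem_range] at hρ
      rw [Nat.choose_eq_zero_of_lt (show m + n - ρ < m by omega), mul_zero, zero_mul]
  · have h1 : l.choose n = ∑ ρ ∈ Finset.range (n + 1), m.choose ρ * (l - m).choose (n - ρ) := by
      conv_lhs => rw [← Nat.add_sub_cancel' h]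
      rw [Nat.add_choose_eq, Finset.Nat.sum_antidiagonal_eq_sum_range_succ_mk]
    rw [h1, Finset.mul_sum]
    have h2 : ∀ ρ ∈ Finset.range (n + 1), l.choose m * (m.choose ρ * (l - m).choose (n - ρ)) =
        m.choose ρ * (m + n - ρ).choose m * l.choose (m + n - ρ) := by
      intro ρ hρ
      have hρ' : ρ ≤ n := by simpa [Nat.lt_succ_iff] using hρ
      have := Nat.choose_mul (n := l) (k := m + n - ρ) (s := m) (by omega)
      rw [show m + n - ρ - m = n - ρ by omega] at this
      rw [mul_left_comm, ← this]; ring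
    rw [Finset.sum_congr rfl h2]
    -- Vandermonde ends the sum at `n`, the statement at `m`; all terms beyond `min m n` vanish, so
    -- both ends are legitimate.
    have key : ∀ N, ∑ ρ ∈ Finset.range (N + 1),
        m.choose ρ * (m + n - ρ).choose m * l.choose (m + n - ρ) =
        ∑ ρ ∈ Finset.range (min N (min m n) + 1),
          m.choose ρ * (m + n - ρ).choose m * l.choose (m + n - ρ) := by
      intro N
      refine (Finset.sum_subset (Finset.range_subset_range.2 (by omega)) fun ρ hρ hρ' => ?_).symm
      rw [Finset.mem_range] at hρ hρ'
      rcases le_or_gt ρ m with h' | h'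
      · rw [Nat.choose_eq_zero_of_lt (show m + n - ρ < m by omega), mul_zero, zero_mul]
      · rw [Nat.choose_eq_zero_of_lt h', zero_mul, zero_mul]
    rw [key n, key m, show min n (min m n) = min m (min m n) by omega]

/-- Only `r = ρ + j` contributes. With `n = ρ + N` the sum over `j` is the alternating Vandermonde
sum for `a = -N` and base `b + ρ`. -/
theorem sum_choose_descFactorial_poch (b : ℂ) (m n ρ : ℕ) (hρ : ρ ≤ m) (hb : poch b m ≠ 0) :
    ∑ r ∈ Finset.range (m + 1), (m.choose r : ℂ) * (n.descFactorial r : ℂ) * (r.choose ρ : ℂ) *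
        (poch b m * poch b n / poch b r) =
      (m.choose ρ : ℂ) * (n.descFactorial ρ : ℂ) * poch b (m + n - ρ) := by
  obtain ⟨M, rfl⟩ := Nat.exists_eq_add_of_le hρ
  rw [add_assoc, Finset.sum_range_add, Finset.sum_eq_zero, zero_add]
  swap
  · intro r hr
    simp [Nat.choose_eq_zero_of_lt (Finset.mem_range.1 hr)]
  rcases lt_or_ge n ρ with h | h
  · rw [Nat.descFactorial_eq_zero_iff_lt.2 h, Nat.cast_zero, mul_zero, zero_mul]
    refine Finset.sum_eq_zero fun j _ => ?_
    rw [Nat.descFactorial_eq_zero_iff_lt.2 (by omega), Nat.cast_zero, mul_zero, zero_mul, zero_mul]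
  · obtain ⟨N, rfl⟩ := Nat.exists_eq_add_of_le h
    have hv := poch_vandermonde_alternating (-(N : ℂ)) (b + ρ) M
    rw [show ρ + M + (ρ + N) - ρ = (ρ + N) + M by omega, poch_add b (ρ + N) M,
      show b + ((ρ + N : ℕ) : ℂ) = b + ρ - -(N : ℂ) by push_cast; ring, ← hv,
      Finset.Nat.sum_antidiagonal_eq_sum_range_succ_mk, Finset.mul_sum, Finset.mul_sum]
    refine Finset.sum_congr rfl fun j hj => ?_
    have hj' : j ≤ M := by simpa [Nat.lt_succ_iff] using hj
    have e1 : (((ρ + M).choose (ρ + j) * (ρ + j).choose ρ : ℕ) : ℂ) =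
        ((ρ + M).choose ρ * M.choose j : ℕ) := by
      have := Nat.choose_mul (n := ρ + M) (k := ρ + j) (s := ρ) (by omega)
      rw [show ρ + M - ρ = M by omega, show ρ + j - ρ = j by omega] at this
      rw [this]
    have e2 : (((ρ + N).descFactorial (ρ + j) : ℕ) : ℂ) =
        (N.descFactorial j * (ρ + N).descFactorial ρ : ℕ) := by
      congr 1
      have := Nat.descFactorial_mul_descFactorial (n := ρ + N) (k := ρ) (m := ρ + j) (by omega)
      rw [show ρ + N - ρ = N by omega, show ρ + j - ρ = j by omega] at this
      rw [this]
    have e3 : poch b (ρ + M) = poch b (ρ + j) * poch (b + ρ + j) (M - j) := by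
      rw [add_assoc, ← Nat.cast_add, ← poch_add]; congr 1; omega
    have h0 : poch b (ρ + j) ≠ 0 := fun h0 => hb (by rw [e3, h0, zero_mul])
    have e4 : (-1 : ℂ) ^ j * poch (-(N : ℂ)) j = (N.descFactorial j : ℂ) := by
      have : ((-1 : ℂ) ^ j) * (-1) ^ j = 1 := by rw [← mul_pow]; simp
      rw [poch_neg_natCast, Nat.descFactorial_eq_factorial_mul_choose]
      push_cast
      linear_combination (j.factorial : ℂ) * (N.choose j : ℂ) * this
    rw [e2, e3, show ∀ x y z : ℂ, x * y * z / x = if x = 0 then 0 else y * z from fun x y z => by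
      split_ifs with h
      · simp [h]
      · field_simp, if_neg h0]
    push_cast at e1 ⊢
    linear_combination ((N.descFactorial j : ℂ) * ((ρ + N).descFactorial ρ : ℂ) *
      (poch (b + ρ + j) (M - j) * poch b (ρ + N))) * e1 -
      (((ρ + M).choose ρ : ℂ) * ((ρ + N).descFactorial ρ : ℂ) * (M.choose j : ℂ) *
      poch (b + ρ + j) (M - j) * poch b (ρ + N)) * e4

/-- The coefficient of `x^{2m} y^{2n}` in the even part of the `(m+n)`-th power of
`S x² + S y² - 2 x y √(S(1+S))`, up to the factor `(m+n)!`. -/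
noncomputable def evenPowerCoeff (S : ℂ) (m n : ℕ) : ℂ :=
  ∑ r ∈ Finset.range (m + 1), (m.choose r : ℂ) * (n.descFactorial r : ℂ) /
    (m.factorial * n.factorial * poch (1 / 2) r) * (S ^ (m + n - r) * (1 + S) ^ r)

/-- Expanding `(1 + S)^r` and summing over `r` first gives pure powers of `S`, the shape produced by
the linearized product of binomials. -/
theorem poch_mul_evenPowerCoeff (S : ℂ) (m n : ℕ) :
    poch (1 / 2) m * poch (1 / 2) n * evenPowerCoeff S m n =
      ∑ ρ ∈ Finset.range (m + 1), (m.choose ρ : ℂ) * ((m + n - ρ).choose m : ℂ) *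
        (poch (1 / 2) (m + n - ρ) / (m + n - ρ).factorial) * S ^ (m + n - ρ) := by
  have hm : (m.factorial : ℂ) ≠ 0 := by exact_mod_cast m.factorial_ne_zero
  have hn : (n.factorial : ℂ) ≠ 0 := by exact_mod_cast n.factorial_ne_zero
  have hp : ∀ k, poch (1 / 2) k ≠ 0 := poch_ne_zero_of_re_pos (by norm_num)
  have h1 : ∀ r ∈ Finset.range (m + 1), poch (1 / 2) m * poch (1 / 2) n *
      ((m.choose r : ℂ) * (n.descFactorial r : ℂ) /
        (m.factorial * n.factorial * poch (1 / 2) r) * (S ^ (m + n - r) * (1 + S) ^ r)) =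
      ∑ ρ ∈ Finset.range (m + 1), (m.choose r : ℂ) * (n.descFactorial r : ℂ) * (r.choose ρ : ℂ) *
        (poch (1 / 2) m * poch (1 / 2) n / poch (1 / 2) r) *
        (S ^ (m + n - ρ) / (m.factorial * n.factorial)) := by
    intro r hr
    have hr' : r ≤ m := by simpa [Nat.lt_succ_iff] using hr
    have h2 : S ^ (m + n - r) * (1 + S) ^ r =
        ∑ ρ ∈ Finset.range (m + 1), (r.choose ρ : ℂ) * S ^ (m + n - ρ) := by
      rw [add_pow, Finset.mul_sum]
      rw [← Finset.sum_subset (Finset.range_subset_range.2 (show r + 1 ≤ m + 1 by omega))]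
      · refine Finset.sum_congr rfl fun ρ hρ => ?_
        have hρ' : ρ ≤ r := by simpa [Nat.lt_succ_iff] using hρ
        rw [show m + n - ρ = (m + n - r) + (r - ρ) by omega, pow_add]
        simp; ring
      · intro ρ _ hρ
        simp only [Finset.mem_range, not_lt] at hρ
        simp [Nat.choose_eq_zero_of_lt (show r < ρ by omega)]
    rw [h2, Finset.mul_sum, Finset.mul_sum]
    refine Finset.sum_congr rfl fun ρ _ => ?_
    have := hp r
    field_simp
  rw [evenPowerCoeff, Finset.mul_sum, Finset.sum_congr rfl h1, Finset.sum_comm]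
  refine Finset.sum_congr rfl fun ρ hρ => ?_
  have hρ' : ρ ≤ m := by simpa [Nat.lt_succ_iff] using hρ
  rw [← Finset.sum_mul, sum_choose_descFactorial_poch _ _ _ _ hρ' (hp m)]
  rcases lt_or_ge n ρ with h | h
  · rw [Nat.descFactorial_eq_zero_iff_lt.2 h, Nat.choose_eq_zero_of_lt (show m + n - ρ < m by omega)]
    simp
  · obtain ⟨N, rfl⟩ := Nat.exists_eq_add_of_le h
    rw [show m + (ρ + N) - ρ = N + m by omega]
    have e1 : (((N + m).choose m * N.factorial * m.factorial : ℕ) : ℂ) = (N + m).factorial := by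
      rw [Nat.add_choose_mul_factorial_mul_factorial]
    have e2 : ((N.factorial * (ρ + N).descFactorial ρ : ℕ) : ℂ) = (ρ + N).factorial := by
      have := Nat.factorial_mul_descFactorial (n := ρ + N) (k := ρ) (by omega)
      rw [show ρ + N - ρ = N by omega] at this
      rw [this]
    have h3 : ((N + m).factorial : ℂ) ≠ 0 := by exact_mod_cast (N + m).factorial_ne_zero
    push_cast at e1 e2
    field_simp
    rw [← e1, ← e2]
    ring

theorem hasSum_mehler_even (α : ℝ) (m n : ℕ) :
    HasSum (fun l : ℕ => poch (1 / 2) l / (l.factorial : ℂ) * ((l.choose m : ℂ) * (l.choose n : ℂ)) *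
        ((Real.tanh α : ℂ) ^ 2) ^ l)
      (Real.cosh α * (poch (1 / 2) m * poch (1 / 2) n *
        evenPowerCoeff ((Real.sinh α : ℂ) ^ 2) m n)) := by
  have h := hasSum_sum (s := Finset.range (m + 1)) fun ρ _ =>
    (hasSum_poch_half_choose α (m + n - ρ)).mul_left
      ((m.choose ρ : ℂ) * ((m + n - ρ).choose m : ℂ))
  rw [poch_mul_evenPowerCoeff, Finset.mul_sum]
  rw [show (∑ ρ ∈ Finset.range (m + 1), (Real.cosh α : ℂ) * ((m.choose ρ : ℂ) *
      ((m + n - ρ).choose m : ℂ) * (poch (1 / 2) (m + n - ρ) / (m + n - ρ).factorial) *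
      ((Real.sinh α : ℂ) ^ 2) ^ (m + n - ρ))) = ∑ ρ ∈ Finset.range (m + 1),
      (m.choose ρ : ℂ) * ((m + n - ρ).choose m : ℂ) * (Real.cosh α *
        (poch (1 / 2) (m + n - ρ) / (m + n - ρ).factorial) *
        ((Real.sinh α : ℂ) ^ 2) ^ (m + n - ρ)) from
    Finset.sum_congr rfl fun ρ _ => by ring]
  refine h.congr_fun fun l => ?_
  rw [← Nat.cast_mul, choose_mul_choose_eq_sum l m n]
  push_cast
  rw [Finset.mul_sum, Finset.sum_mul]
  exact Finset.sum_congr rfl fun ρ _ => by ring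

/-! ### Moments of the coordinates on the unit sphere -/

/-- The Gaussian integral is computed in polar coordinates here and as a product below; comparing
the two gives the sphere moments. -/
theorem integral_coord_pow_mul_gaussian_polar (n : ℕ) (i : Fin n) (k : ℕ) :
    ∫ x : EuclideanSpace ℝ (Fin n), x i ^ k * Real.exp (-‖x‖ ^ 2) =
      (∫ z : USphere n, z.1 i ^ k ∂(volume : Measure (EuclideanSpace ℝ (Fin n))).toSphere) *
        ∫ r in Set.Ioi (0 : ℝ), r ^ (n - 1) * (r ^ k * Real.exp (-r ^ 2)) := by
  have : Nonempty (Fin n) := ⟨i⟩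
  let μ : Measure (EuclideanSpace ℝ (Fin n)) := volume
  calc
    _ = ∫ x : ({(0)}ᶜ : Set (EuclideanSpace ℝ (Fin n))), x.1 i ^ k * Real.exp (-‖x.1‖ ^ 2) ∂(μ.comap (↑)) := by
      rw [integral_subtype_comap (measurableSet_singleton _).compl
        fun x : EuclideanSpace ℝ (Fin n) => x i ^ k * Real.exp (-‖x‖ ^ 2), restrict_compl_singleton]
    _ = ∫ x, (x.1.1 i ^ k) * (x.2.1 ^ k * Real.exp (-x.2.1 ^ 2))
        ∂μ.toSphere.prod (.volumeIoiPow (Module.finrank ℝ (EuclideanSpace ℝ (Fin n)) - 1)) := by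
      rw [← μ.measurePreserving_homeomorphUnitSphereProd.integral_comp
        (Homeomorph.measurableEmbedding _)]
      congr with x
      have hx : ‖x.1‖ ≠ 0 := norm_ne_zero_iff.2 x.2
      rw [homeomorphUnitSphereProd_apply_snd_coe, homeomorphUnitSphereProd_apply_fst_coe]
      rw [← mul_assoc, ← mul_pow]
      congr 2
      simp
      field_simp
    _ = (∫ z : USphere n, z.1 i ^ k ∂μ.toSphere) * ∫ x : Set.Ioi (0 : ℝ),
        (x.1 ^ k * Real.exp (-x.1 ^ 2)) ∂.volumeIoiPow (Module.finrank ℝ (EuclideanSpace ℝ (Fin n)) - 1) :=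
      integral_prod_mul (fun z : USphere n => z.1 i ^ k)
        (fun x : Set.Ioi (0 : ℝ) => x.1 ^ k * Real.exp (-x.1 ^ 2))
    _ = _ := by
      congr 1
      simp only [Measure.volumeIoiPow, ENNReal.ofReal]
      rw [integral_withDensity_eq_integral_smul,
        integral_subtype_comap measurableSet_Ioi fun a =>
          Real.toNNReal (a ^ (Module.finrank ℝ (EuclideanSpace ℝ (Fin n)) - 1)) • (a ^ k * Real.exp (-a ^ 2)),
        setIntegral_congr_fun measurableSet_Ioi fun x hx => ?_]
      · rw [NNReal.smul_def, Real.coe_toNNReal _ (pow_nonneg (le_of_lt hx) _)]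
        simp
      · exact (measurable_subtype_coe.pow_const _).real_toNNReal

theorem integral_coord_pow_mul_gaussian_prod (n : ℕ) (i : Fin n) (k : ℕ) :
    ∫ x : EuclideanSpace ℝ (Fin n), x i ^ k * Real.exp (-‖x‖ ^ 2) =
      (∫ x : ℝ, x ^ k * Real.exp (-x ^ 2)) * (∫ x : ℝ, Real.exp (-x ^ 2)) ^ (n - 1) := by
  rw [← (PiLp.volume_preserving_toLp (Fin n)).integral_comp
    (MeasurableEquiv.toLp 2 (Fin n → ℝ)).measurableEmbedding]
  have h : ∀ x : Fin n → ℝ, (WithLp.toLp 2 x : EuclideanSpace ℝ (Fin n)) i ^ k *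
      Real.exp (-‖(WithLp.toLp 2 x : EuclideanSpace ℝ (Fin n))‖ ^ 2) =
      ∏ j, (if j = i then x j ^ k else 1) * Real.exp (-x j ^ 2) := by
    intro x
    rw [EuclideanSpace.real_norm_sq_eq, Finset.prod_mul_distrib, ← Real.exp_sum]
    simp
  simp_rw [h]
  rw [integral_fintype_prod_volume_eq_prod
    (fun (j : Fin n) (x : ℝ) => (if j = i then x ^ k else 1) * Real.exp (-x ^ 2)),
    ← Finset.mul_prod_erase _ _ (Finset.mem_univ i)]
  congr 1
  · simp
  · rw [Finset.prod_congr rfl (g := fun _ => ∫ x : ℝ, Real.exp (-x ^ 2))]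
    · simp
    · intro j hj
      simp [Finset.ne_of_mem_erase hj]

theorem integral_Ioi_pow_mul_gaussian (k : ℕ) :
    ∫ r in Set.Ioi (0 : ℝ), r ^ k * Real.exp (-r ^ 2) = 1 / 2 * Real.Gamma ((k + 1) / 2) := by
  have h := integral_rpow_mul_exp_neg_rpow (p := 2) (q := k) (by norm_num)
    (by linarith [(Nat.cast_nonneg k : (0 : ℝ) ≤ k)])
  rw [← h]
  simp only [Real.rpow_natCast, Real.rpow_two]

theorem integral_pow_mul_gaussian_of_odd {k : ℕ} (hk : Odd k) :
    ∫ x : ℝ, x ^ k * Real.exp (-x ^ 2) = 0 := by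
  have h := integral_neg_eq_self (fun x : ℝ => x ^ k * Real.exp (-x ^ 2)) volume
  simp only [hk.neg_pow, neg_sq, neg_mul, integral_neg] at h
  linarith

theorem integral_pow_mul_gaussian_of_even {k : ℕ} (hk : Even k) :
    ∫ x : ℝ, x ^ k * Real.exp (-x ^ 2) = Real.Gamma ((k + 1) / 2) := by
  have h := integral_comp_abs (f := fun x : ℝ => x ^ k * Real.exp (-x ^ 2))
  simp only [hk.pow_abs, sq_abs] at h
  rw [h, integral_Ioi_pow_mul_gaussian]
  ring

theorem gamma_add_natCast {a : ℝ} (ha : 0 < a) (m : ℕ) :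
    (Real.Gamma (a + m) : ℂ) = poch a m * Real.Gamma a := by
  induction m with
  | zero => simp
  | succ m ih =>
    rw [Nat.cast_succ, ← add_assoc, Real.Gamma_add_one (by positivity), Complex.ofReal_mul, ih,
      poch_succ]
    push_cast; ring

instance isProbabilityMeasure_sphereMeasure (n : ℕ) [NeZero n] :
    IsProbabilityMeasure (sphereMeasure n) := by
  have : Nonempty (Fin n) := ⟨0⟩
  constructor
  rw [sphereMeasure, Measure.smul_apply, smul_eq_mul]
  exact ENNReal.inv_mul_cancel (by
    rw [Measure.measure_univ_ne_zero]; exact Measure.toSphere_ne_zero _) (measure_ne_top _ _)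

/-- The `k`-th moment of a coordinate on the unit sphere of `ℝⁿ`. -/
noncomputable def sphereMoment (n k : ℕ) : ℂ :=
  if Even k then poch (1 / 2) (k / 2) / poch (n / 2) (k / 2) else 0

theorem integral_sphere_pow (n : ℕ) [NeZero n] (i : Fin n) (k : ℕ) :
    ∫ z : USphere n, ((z.1 i : ℝ) : ℂ) ^ k ∂sphereMeasure n = sphereMoment n k := by
  have : Nonempty (Fin n) := ⟨0⟩
  have hn : 0 < n := Nat.pos_of_ne_zero (NeZero.ne n)
  have hn' : (0 : ℝ) < n := by exact_mod_cast hn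
  set μ := (volume : Measure (EuclideanSpace ℝ (Fin n))).toSphere with hμ
  have hR : ∀ k : ℕ, ∫ r in Set.Ioi (0 : ℝ), r ^ (n - 1) * (r ^ k * Real.exp (-r ^ 2)) =
      1 / 2 * Real.Gamma ((k + n) / 2) := by
    intro k
    simp_rw [← mul_assoc, ← pow_add]
    rw [integral_Ioi_pow_mul_gaussian]
    congr 3
    push_cast [hn]
    ring
  have h1 := fun k => (integral_coord_pow_mul_gaussian_polar n i k).symm.trans
    (integral_coord_pow_mul_gaussian_prod n i k)
  simp only [hR] at h1
  have h0 := h1 0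
  have hG0 := integral_pow_mul_gaussian_of_even (k := 0) (by simp)
  have hpi : 0 < Real.Gamma (((0 : ℕ) + 1) / 2) := Real.Gamma_pos_of_pos (by norm_num)
  have hk1 : 0 < Real.Gamma ((k + n) / 2) := Real.Gamma_pos_of_pos (by positivity)
  have hk0 : 0 < Real.Gamma (((0 : ℕ) + n) / 2) := Real.Gamma_pos_of_pos (by
    rw [Nat.cast_zero, zero_add]; positivity)
  rw [hG0] at h0
  simp only [pow_zero, one_mul] at hG0
  -- The case `k = 0` gives the total mass of the unnormalized surface measure, by which the `k`-th
  -- identity is divided.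
  simp only [pow_zero, integral_const, smul_eq_mul, mul_one] at h0
  have hk := h1 k
  rw [hG0] at h0 hk
  have hI : ∫ z : USphere n, z.1 i ^ k ∂sphereMeasure n =
      (μ.real Set.univ)⁻¹ * ∫ z : USphere n, z.1 i ^ k ∂μ := by
    rw [sphereMeasure, integral_smul_measure, smul_eq_mul, ENNReal.toReal_inv]; rfl
  have hμ0 : μ.real Set.univ ≠ 0 := by
    intro h
    rw [h, zero_mul] at h0
    exact (mul_pos hpi (pow_pos hpi _)).ne h0
  have hI2 : ∫ z : USphere n, z.1 i ^ k ∂sphereMeasure n =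
      (∫ x : ℝ, x ^ k * Real.exp (-x ^ 2)) * Real.Gamma (((0 : ℕ) + n) / 2) /
        (Real.Gamma (((0 : ℕ) + 1) / 2) * Real.Gamma ((k + n) / 2)) := by
    rw [hI]
    have hp := (pow_pos hpi (n - 1)).ne'
    rw [eq_div_iff (by positivity), inv_mul_eq_div, div_mul_eq_mul_div, div_eq_iff hμ0]
    refine mul_right_cancel₀ hp ?_
    linear_combination 2 * Real.Gamma (((0 : ℕ) + 1) / 2) * Real.Gamma (((0 : ℕ) + 1) / 2) ^ (n - 1)
      * hk - 2 * (∫ x : ℝ, x ^ k * Real.exp (-x ^ 2)) * Real.Gamma (((0 : ℕ) + 1) / 2) ^ (n - 1) * h0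
  have hI3 : ∫ z : USphere n, ((z.1 i : ℝ) : ℂ) ^ k ∂sphereMeasure n =
      ((∫ z : USphere n, z.1 i ^ k ∂sphereMeasure n : ℝ) : ℂ) := by
    rw [← integral_complex_ofReal]; simp
  rw [hI3, hI2, sphereMoment]
  split_ifs with he
  · obtain ⟨m, rfl⟩ := he
    rw [integral_pow_mul_gaussian_of_even (by simp)]
    have e1 := gamma_add_natCast (a := 1 / 2) (by norm_num) m
    have e2 := gamma_add_natCast (a := n / 2) (by positivity) m
    rw [show ((m + m : ℕ) + 1 : ℝ) / 2 = 1 / 2 + m by push_cast; ring,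
      show ((m + m : ℕ) + n : ℝ) / 2 = n / 2 + m by push_cast; ring,
      show ((0 : ℕ) + 1 : ℝ) / 2 = 1 / 2 by push_cast; ring,
      show ((0 : ℕ) + n : ℝ) / 2 = n / 2 by push_cast; ring,
      show (m + m) / 2 = m by omega]
    push_cast at e1 e2 ⊢
    rw [e1, e2]
    have g1 : (Real.Gamma (1 / 2) : ℂ) ≠ 0 := by
      exact_mod_cast (Real.Gamma_pos_of_pos (by norm_num)).ne'
    have g2 : (Real.Gamma (n / 2) : ℂ) ≠ 0 := by
      exact_mod_cast (Real.Gamma_pos_of_pos (by positivity)).ne'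
    have g3 : poch ((n : ℂ) / 2) m ≠ 0 := poch_ne_zero_of_re_pos (by simp [hn]) m
    field_simp
  · rw [integral_pow_mul_gaussian_of_odd (Nat.not_even_iff_odd.1 he)]
    simp

/-! ### The zonal function as an integral -/

/-- The square of `ω` at the image of a point of the section under a hyperbolic rotation. -/
noncomputable def omegaSq (α x y : ℝ) : ℝ :=
  1 + (Real.sinh α ^ 2 * y ^ 2 + Real.sinh α ^ 2 * x ^ 2 -
    2 * Real.cosh α * Real.sinh α * (x * y))

theorem omega_act_hypRotation_inv (p q : ℕ) [NeZero p] [NeZero q] (α : ℝ)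
    (z : USphere q × USphere p) :
    (Cone.act (hypRotation p q α)⁻¹ (sectionPoint z)).omega =
      Real.sqrt (omegaSq α (z.1.1 0) (z.2.1 (Fin.rev 0))) := by
  have hx : ∑ i, z.1.1 i ^ 2 = 1 := by
    rw [← EuclideanSpace.real_norm_sq_eq, norm_eq_of_mem_sphere]; norm_num
  have h : (Cone.act (hypRotation p q α)⁻¹ (sectionPoint z)).1 =
      hypMatrix p q (-α) *ᵥ (sectionPoint z).1 := rfl
  rw [Cone.omega, h, hypMatrix_mulVec]
  congr 1
  rw [← Finset.add_sum_erase _ _ (Finset.mem_univ (0 : Fin q))] at hx ⊢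
  have e1 : ∀ (k : Fin q ⊕ Fin p → ℝ) (u v : ℝ), ∑ x ∈ Finset.univ.erase (0 : Fin q),
      (Function.update (Function.update k
      (Sum.inl 0) u) (Sum.inr (Fin.rev 0)) v (Sum.inl x)) ^ 2 =
      ∑ x ∈ Finset.univ.erase (0 : Fin q), k (Sum.inl x) ^ 2 := fun k u v =>
    Finset.sum_congr rfl fun x hx => by simp [Finset.ne_of_mem_erase hx]
  rw [e1]
  rw [Function.update_of_ne (by simp), Function.update_self]
  simp only [sectionPoint, Sum.elim_inl, Sum.elim_inr, omegaSq, Real.cosh_neg, Real.sinh_neg]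
  linear_combination hx + (z.1.1 0) ^ 2 * Real.cosh_sq α

theorem Z_eq_integral (p q : ℕ) [NeZero p] [NeZero q] (σ : ℂ) (α : ℝ) :
    Z p q σ α = ∫ z : USphere q × USphere p,
      (Real.sqrt (omegaSq α (z.1.1 0) (z.2.1 (Fin.rev 0))) : ℂ) ^ σ
        ∂((sphereMeasure q).prod (sphereMeasure p)) := by
  rw [Z, scalarProduct]
  congr with z
  have hx : ∑ i, z.1.1 i ^ 2 = 1 := by
    rw [← EuclideanSpace.real_norm_sq_eq, norm_eq_of_mem_sphere]; norm_num
  have h1 : (sectionPoint z).omega = 1 := by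
    rw [Cone.omega, Real.sqrt_eq_one]; exact hx
  simp only [T, invariantVector, omega_act_hypRotation_inv, h1]
  simp

theorem abs_coord_le_one {n : ℕ} (z : USphere n) (i : Fin n) : |z.1 i| ≤ 1 := by
  have hz : ‖z.1‖ = 1 := norm_eq_of_mem_sphere z
  exact (PiLp.norm_apply_le z.1 i).trans hz.le

theorem integral_prod_coord_pow (p q : ℕ) [NeZero p] [NeZero q] (a b : ℕ) :
    ∫ z : USphere q × USphere p, ((z.1.1 0 : ℝ) : ℂ) ^ a * ((z.2.1 (Fin.rev 0) : ℝ) : ℂ) ^ b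
      ∂((sphereMeasure q).prod (sphereMeasure p)) = sphereMoment q a * sphereMoment p b := by
  rw [integral_prod_mul (fun z : USphere q => ((z.1 0 : ℝ) : ℂ) ^ a)
    (fun z : USphere p => ((z.1 (Fin.rev 0) : ℝ) : ℂ) ^ b), integral_sphere_pow,
    integral_sphere_pow]

theorem integrable_of_continuous_sphere (p q : ℕ) [NeZero p] [NeZero q]
    {f : USphere q × USphere p → ℂ} (hf : Continuous f) :
    Integrable f ((sphereMeasure q).prod (sphereMeasure p)) :=
  hf.integrable_of_hasCompactSupport (HasCompactSupport.of_compactSpace f)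

/-! ### Even integral degree -/

theorem factorial_two_mul (r : ℕ) :
    ((2 * r).factorial : ℂ) = 4 ^ r * r.factorial * poch (1 / 2) r := by
  induction r with
  | zero => simp
  | succ r ih =>
    rw [show 2 * (r + 1) = 2 * r + 1 + 1 by ring, Nat.factorial_succ, Nat.factorial_succ,
      Nat.factorial_succ, poch_succ]
    push_cast
    rw [ih]; ring

/-- Matches a trinomial coefficient of the expanded power with a term of `evenPowerCoeff`; `(2r)! =
4^r r! (1/2)_r` accounts for `4^r`. -/
theorem factorial_mul_evenPowerCoeff_term (k r a b : ℕ) (h : 2 * r + (a + b) = k) :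
    (k.choose (2 * r) : ℂ) * ((a + b).choose a : ℂ) * 4 ^ r =
      k.factorial * (((r + a).choose r : ℂ) * ((r + b).descFactorial r : ℂ) /
        ((r + a).factorial * (r + b).factorial * poch (1 / 2) r)) := by
  subst h
  have e1 := Nat.add_choose_mul_factorial_mul_factorial (2 * r) (a + b)
  have e2 := Nat.add_choose_mul_factorial_mul_factorial a b
  have e3 := Nat.add_choose_mul_factorial_mul_factorial r a
  have e4 := Nat.factorial_mul_descFactorial (n := r + b) (k := r) (by omega)
  rw [← Nat.choose_symm_add] at e1 e2 e3
  rw [Nat.add_sub_cancel_left] at e4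
  have hf : ∀ n : ℕ, (n.factorial : ℂ) ≠ 0 := fun n => by exact_mod_cast n.factorial_ne_zero
  have hp : poch (1 / 2) r ≠ 0 := poch_ne_zero_of_re_pos (by norm_num) r
  replace e1 := congrArg (Nat.cast (R := ℂ)) e1
  replace e2 := congrArg (Nat.cast (R := ℂ)) e2
  replace e3 := congrArg (Nat.cast (R := ℂ)) e3
  replace e4 := congrArg (Nat.cast (R := ℂ)) e4
  push_cast at e1 e2 e3 e4
  rw [← e1, ← e2, ← e3, ← e4, factorial_two_mul]
  have h1 := hf b
  have h2 := hf a
  have h3 := hf r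
  have h4 : ((r + a).choose r : ℂ) ≠ 0 := by exact_mod_cast (Nat.choose_pos (by omega)).ne'
  have h5 : ((r + b).descFactorial r : ℂ) ≠ 0 := by
    exact_mod_cast (Nat.descFactorial_pos.2 (by omega)).ne'
  field_simp

theorem sphereMoment_two_mul (n m : ℕ) :
    sphereMoment n (2 * m) = poch (1 / 2) m / poch (n / 2) m := by
  simp [sphereMoment]

theorem integral_pow_omegaSq_sub_one (p q : ℕ) [NeZero p] [NeZero q] (α : ℝ) (k : ℕ) :
    ∫ z : USphere q × USphere p,
      ((omegaSq α (z.1.1 0) (z.2.1 (Fin.rev 0)) - 1 : ℝ) : ℂ) ^ k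
        ∂((sphereMeasure q).prod (sphereMeasure p)) =
      k.factorial * ∑ mn ∈ Finset.HasAntidiagonal.antidiagonal k,
        evenPowerCoeff ((Real.sinh α : ℂ) ^ 2) mn.1 mn.2 *
          (sphereMoment p (2 * mn.1) * sphereMoment q (2 * mn.2)) := by
  set S : ℂ := (Real.sinh α : ℂ) ^ 2 with hS
  set w : ℂ := -2 * Real.cosh α * Real.sinh α with hw
  -- Only even powers of the cross term survive integration, so the square root of `S (1 + S)`
  -- disappears.
  have hw2 : w ^ 2 = 4 * S * (1 + S) := by
    have := Real.cosh_sq α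
    have h : (Real.cosh α : ℂ) ^ 2 = (Real.sinh α : ℂ) ^ 2 + 1 := by exact_mod_cast this
    rw [hw, hS]; linear_combination 4 * (Real.sinh α : ℂ) ^ 2 * h
  have hexp : ∀ z : USphere q × USphere p,
      ((omegaSq α (z.1.1 0) (z.2.1 (Fin.rev 0)) - 1 : ℝ) : ℂ) ^ k =
      ∑ ji ∈ Finset.HasAntidiagonal.antidiagonal k, ∑ ab ∈ Finset.HasAntidiagonal.antidiagonal ji.2,
        ((k.choose ji.1 : ℂ) * (ji.2.choose ab.1 : ℂ) * (w ^ ji.1 * S ^ ji.2)) *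
        (((z.1.1 0 : ℝ) : ℂ) ^ (ji.1 + 2 * ab.2) *
          ((z.2.1 (Fin.rev 0) : ℝ) : ℂ) ^ (ji.1 + 2 * ab.1)) := by
    intro z
    have h : ((omegaSq α (z.1.1 0) (z.2.1 (Fin.rev 0)) - 1 : ℝ) : ℂ) =
        w * ((z.1.1 0 : ℝ) * (z.2.1 (Fin.rev 0) : ℝ)) +
        (S * ((z.2.1 (Fin.rev 0) : ℝ) : ℂ) ^ 2 + S * ((z.1.1 0 : ℝ) : ℂ) ^ 2) := by
      rw [omegaSq, hS, hw]; push_cast; ring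
    rw [h, (Commute.all _ _).add_pow']
    refine Finset.sum_congr rfl fun ji _ => ?_
    rw [(Commute.all _ _).add_pow', nsmul_eq_mul, Finset.mul_sum, Finset.mul_sum]
    refine Finset.sum_congr rfl fun ab hab => ?_
    rw [nsmul_eq_mul, ← Finset.HasAntidiagonal.mem_antidiagonal.1 hab]
    ring
  simp_rw [hexp]
  rw [integral_finsetSum]
  swap
  · intro ji _
    apply integrable_of_continuous_sphere
    fun_prop
  have hint : ∀ ji ∈ Finset.HasAntidiagonal.antidiagonal k,
      ∫ z : USphere q × USphere p, ∑ ab ∈ Finset.HasAntidiagonal.antidiagonal ji.2,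
        ((k.choose ji.1 : ℂ) * (ji.2.choose ab.1 : ℂ) * (w ^ ji.1 * S ^ ji.2)) *
        (((z.1.1 0 : ℝ) : ℂ) ^ (ji.1 + 2 * ab.2) *
          ((z.2.1 (Fin.rev 0) : ℝ) : ℂ) ^ (ji.1 + 2 * ab.1))
        ∂((sphereMeasure q).prod (sphereMeasure p)) =
      ∑ ab ∈ Finset.HasAntidiagonal.antidiagonal ji.2,
        ((k.choose ji.1 : ℂ) * (ji.2.choose ab.1 : ℂ) * (w ^ ji.1 * S ^ ji.2)) *
        (sphereMoment q (ji.1 + 2 * ab.2) * sphereMoment p (ji.1 + 2 * ab.1)) := by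
    intro ji _
    rw [integral_finsetSum]
    · refine Finset.sum_congr rfl fun ab _ => ?_
      rw [integral_const_mul, integral_prod_coord_pow]
    · intro ab _
      apply integrable_of_continuous_sphere
      fun_prop
  rw [Finset.sum_congr rfl hint, Finset.sum_sigma', Finset.mul_sum]
  simp only [evenPowerCoeff, Finset.sum_mul, Finset.mul_sum]
  -- On the left odd exponents `j` have zero moment; on the right `r > n` is killed by the falling
  -- factorial. The remaining terms correspond by `j = 2r`, `m = r + a`, `n = r + b`.
  rw [Finset.sum_sigma', ← Finset.sum_filter_of_ne (p := fun x : (_ : ℕ × ℕ) × (ℕ × ℕ) =>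
    Even x.1.1), ← Finset.sum_filter_of_ne (p := fun x : (_ : ℕ × ℕ) × ℕ => x.2 ≤ x.1.2)]
  · refine Finset.sum_nbij' (fun x => ⟨(x.1.1 / 2 + x.2.1, x.1.1 / 2 + x.2.2), x.1.1 / 2⟩)
      (fun x => ⟨(2 * x.2, x.1.1 + x.1.2 - 2 * x.2), (x.1.1 - x.2, x.1.2 - x.2)⟩) ?_ ?_ ?_ ?_ ?_
    · rintro ⟨⟨j, i⟩, ⟨a, b⟩⟩ h
      simp only [Finset.mem_filter, Finset.mem_sigma, Finset.HasAntidiagonal.mem_antidiagonal, Finset.mem_range,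
        Nat.even_iff] at h ⊢
      omega
    · rintro ⟨⟨m, n⟩, r⟩ h
      simp only [Finset.mem_filter, Finset.mem_sigma, Finset.HasAntidiagonal.mem_antidiagonal, Finset.mem_range,
        Nat.even_iff] at h ⊢
      omega
    · rintro ⟨⟨j, i⟩, ⟨a, b⟩⟩ h
      simp only [Finset.mem_filter, Finset.mem_sigma, Finset.HasAntidiagonal.mem_antidiagonal,
        Nat.even_iff] at h
      simp only [Sigma.mk.injEq, Prod.mk.injEq, heq_eq_eq]
      omega
    · rintro ⟨⟨m, n⟩, r⟩ h
      simp only [Finset.mem_filter, Finset.mem_sigma, Finset.HasAntidiagonal.mem_antidiagonal, Finset.mem_range]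
        at h
      simp only [Sigma.mk.injEq, Prod.mk.injEq, heq_eq_eq]
      omega
    · rintro ⟨⟨j, i⟩, ⟨a, b⟩⟩ h
      simp only [Finset.mem_filter, Finset.mem_sigma, Finset.HasAntidiagonal.mem_antidiagonal, even_iff_two_dvd] at h
      obtain ⟨⟨h1, rfl⟩, r, rfl⟩ := h
      simp only [Nat.mul_div_cancel_left r two_pos]
      have h2 := factorial_mul_evenPowerCoeff_term k r a b h1
      rw [show r + a + (r + b) - r = r + (a + b) by omega,
        show 2 * r + 2 * b = 2 * (r + b) by ring, show 2 * r + 2 * a = 2 * (r + a) by ring,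
        pow_mul w, hw2, mul_pow, mul_pow, pow_add S]
      linear_combination (S ^ r * (1 + S) ^ r * S ^ (a + b) *
        (sphereMoment q (2 * (r + b)) * sphereMoment p (2 * (r + a)))) * h2
  · rintro ⟨⟨m, n⟩, r⟩ _ h
    by_contra h2
    refine h ?_
    simp only [not_le] at h2
    simp [Nat.descFactorial_eq_zero_iff_lt.2 h2]
  · rintro ⟨⟨j, i⟩, ⟨a, b⟩⟩ _ h
    by_contra h2
    refine h ?_
    simp [sphereMoment, Nat.even_add, h2]

/-- The signs of the three Pochhammer symbols cancel. Grouping by `k = m + n` matches the expansion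
of `(1 + (ω² - 1))^N`. -/
theorem appellF₂_neg_natCast (N l : ℕ) (c c' : ℂ) :
    appellF₂ (-(N : ℂ)) (-(l : ℂ)) (-(l : ℂ)) c c' 1 1 =
      ∑ k ∈ Finset.range (N + 1), ∑ mn ∈ Finset.HasAntidiagonal.antidiagonal k,
        (N.choose k : ℂ) * k.factorial * ((l.choose mn.1 : ℂ) * (l.choose mn.2 : ℂ) /
          (poch c mn.1 * poch c' mn.2)) := by
  have h0 : ∀ k ∈ Finset.range (N + 1), ∑ mn ∈ Finset.HasAntidiagonal.antidiagonal k,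
      (N.choose k : ℂ) * k.factorial * ((l.choose mn.1 : ℂ) * (l.choose mn.2 : ℂ) /
          (poch c mn.1 * poch c' mn.2)) = ∑ m ∈ Finset.range (k + 1),
        (fun m n => (N.choose (m + n) : ℂ) * (m + n).factorial * ((l.choose m : ℂ) *
          (l.choose n : ℂ) / (poch c m * poch c' n))) m (k - m) := by
    intro k _
    rw [Finset.Nat.sum_antidiagonal_eq_sum_range_succ_mk]
    refine Finset.sum_congr rfl fun m hm => ?_
    have hm' : m ≤ k := by simpa [Nat.lt_succ_iff] using hm
    simp only [Nat.add_sub_cancel' hm']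
  rw [Finset.sum_congr rfl h0, Finset.sum_range_diag_flip (N + 1) (fun m n : ℕ =>
    (N.choose (m + n) : ℂ) * (m + n).factorial * ((l.choose m : ℂ) * (l.choose n : ℂ) /
      (poch c m * poch c' n))), appellF₂,
    tsum_eq_sum (s := Finset.range (N + 1) ×ˢ Finset.range (N + 1)), Finset.sum_product]
  · refine Finset.sum_congr rfl fun m _ => ?_
    rw [← Finset.sum_subset (Finset.range_subset_range.2 (show N + 1 - m ≤ N + 1 by omega))]
    · refine Finset.sum_congr rfl fun n _ => ?_
      have hm : (m.factorial : ℂ) ≠ 0 := by exact_mod_cast m.factorial_ne_zero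
      have hn : (n.factorial : ℂ) ≠ 0 := by exact_mod_cast n.factorial_ne_zero
      simp only [poch_neg_natCast, one_pow, mul_one]
      have h4 : ((-1 : ℂ) ^ (m + n)) * ((-1) ^ m * (-1) ^ n) = 1 := by
        rw [← pow_add, ← mul_pow]; simp
      rw [← mul_div_assoc, ← mul_div_mul_right _ (poch c m * poch c' n) (mul_ne_zero hm hn)]
      congr 1
      · linear_combination ((m + n).factorial * (N.choose (m + n) : ℂ) * (m.factorial *
          (l.choose m : ℂ)) * (n.factorial * (l.choose n : ℂ))) * h4
      · ring
    · intro n _ hn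
      simp only [Finset.mem_range, not_lt] at hn
      simp [poch_neg_natCast, Nat.choose_eq_zero_of_lt (show N < m + n by omega)]
  · rintro ⟨m, n⟩ h
    simp only [Finset.mem_product, Finset.mem_range, not_and_or, not_lt] at h
    simp [poch_neg_natCast, Nat.choose_eq_zero_of_lt (show N < m + n by omega)]

theorem one_sub_mul_pos {τ u : ℝ} (hτ : |τ| < 1) (hu : |u| ≤ 1) : 0 < 1 - τ * u := by
  have : |τ * u| < 1 := by
    rw [abs_mul]; exact mul_lt_one_of_nonneg_of_lt_one_left (abs_nonneg _) hτ hu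
  linarith [(abs_lt.1 this).2]

theorem omegaSq_nonneg (α : ℝ) {x : ℝ} (y : ℝ) (hx : |x| ≤ 1) : 0 ≤ omegaSq α x y := by
  have h : omegaSq α x y = (1 - x ^ 2) + (x * Real.cosh α - y * Real.sinh α) ^ 2 := by
    rw [omegaSq]; linear_combination -x ^ 2 * Real.cosh_sq α
  have := (sq_le_one_iff_abs_le_one x).2 hx
  rw [h]
  nlinarith [sq_nonneg (x * Real.cosh α - y * Real.sinh α)]

theorem hasSum_appellCoeff_even_degree (p q : ℕ) [NeZero p] [NeZero q] (N : ℕ) (α : ℝ) :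
    HasSum (fun l : ℕ => appellCoeff p q (2 * N) l * (Real.tanh α : ℂ) ^ (2 * l))
      (Real.cosh α * Z p q (2 * N) α) := by
  have hZ : Z p q (2 * N) α = ∑ k ∈ Finset.range (N + 1), (N.choose k : ℂ) *
      (k.factorial * ∑ mn ∈ Finset.HasAntidiagonal.antidiagonal k,
        evenPowerCoeff ((Real.sinh α : ℂ) ^ 2) mn.1 mn.2 *
          (sphereMoment p (2 * mn.1) * sphereMoment q (2 * mn.2))) := by
    rw [Z_eq_integral]
    have h : ∀ z : USphere q × USphere p,
        (Real.sqrt (omegaSq α (z.1.1 0) (z.2.1 (Fin.rev 0))) : ℂ) ^ (2 * N : ℂ) =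
        ∑ k ∈ Finset.range (N + 1), (N.choose k : ℂ) *
          ((omegaSq α (z.1.1 0) (z.2.1 (Fin.rev 0)) - 1 : ℝ) : ℂ) ^ k := by
      intro z
      rw [show (2 * N : ℂ) = ((2 * N : ℕ) : ℂ) by push_cast; ring, Complex.cpow_natCast, pow_mul,
        ← Complex.ofReal_pow, Real.sq_sqrt (omegaSq_nonneg α _
          (abs_coord_le_one _ _))]
      conv_lhs => rw [← sub_add_cancel (omegaSq α (z.1.1 0) (z.2.1 (Fin.rev 0))) 1,
        Complex.ofReal_add, Complex.ofReal_one, add_pow]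
      exact Finset.sum_congr rfl fun k _ => by simp; ring
    simp_rw [h]
    rw [integral_finsetSum]
    · refine Finset.sum_congr rfl fun k _ => ?_
      rw [integral_const_mul, integral_pow_omegaSq_sub_one]
    · intro k _
      apply integrable_of_continuous_sphere
      unfold omegaSq
      fun_prop
  have h := hasSum_sum (s := Finset.range (N + 1)) fun k _ =>
    hasSum_sum (s := Finset.HasAntidiagonal.antidiagonal k) fun mn _ =>
      (hasSum_mehler_even α mn.1 mn.2).mul_left ((N.choose k : ℂ) * k.factorial /
        (poch (p / 2) mn.1 * poch (q / 2) mn.2))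
  have hv : Real.cosh α * Z p q (2 * N) α = ∑ k ∈ Finset.range (N + 1),
      ∑ mn ∈ Finset.HasAntidiagonal.antidiagonal k, (N.choose k : ℂ) * k.factorial /
        (poch (p / 2) mn.1 * poch (q / 2) mn.2) * (Real.cosh α * (poch (1 / 2) mn.1 *
          poch (1 / 2) mn.2 * evenPowerCoeff ((Real.sinh α : ℂ) ^ 2) mn.1 mn.2)) := by
    rw [hZ, Finset.mul_sum]
    refine Finset.sum_congr rfl fun k _ => ?_
    rw [Finset.mul_sum, Finset.mul_sum, Finset.mul_sum]
    refine Finset.sum_congr rfl fun mn _ => ?_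
    rw [sphereMoment_two_mul, sphereMoment_two_mul]
    simp only [div_eq_mul_inv, mul_inv]
    ring
  rw [hv]
  refine h.congr_fun fun l => ?_
  rw [appellCoeff, show -(2 * (N : ℂ)) / 2 = -(N : ℂ) by ring, appellF₂_neg_natCast,
    Finset.mul_sum, Finset.sum_mul]
  refine Finset.sum_congr rfl fun k _ => ?_
  rw [Finset.mul_sum, Finset.sum_mul]
  refine Finset.sum_congr rfl fun mn _ => ?_
  rw [pow_mul]
  simp only [div_eq_mul_inv, mul_inv]
  ring

/-! ### Functions given by polynomials -/

/-- A function on `ℂ` which is given by a polynomial. -/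
def IsPolynomialFun (f : ℂ → ℂ) : Prop := ∃ P : Polynomial ℂ, ∀ s, f s = P.eval s

namespace IsPolynomialFun

theorem const (c : ℂ) : IsPolynomialFun fun _ => c := ⟨Polynomial.C c, by simp⟩

theorem id : IsPolynomialFun fun s => s := ⟨Polynomial.X, by simp⟩

theorem add {f g : ℂ → ℂ} (hf : IsPolynomialFun f) (hg : IsPolynomialFun g) :
    IsPolynomialFun fun s => f s + g s := by
  obtain ⟨P, hP⟩ := hf
  obtain ⟨Q, hQ⟩ := hg
  exact ⟨P + Q, by simp [hP, hQ]⟩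

theorem mul {f g : ℂ → ℂ} (hf : IsPolynomialFun f) (hg : IsPolynomialFun g) :
    IsPolynomialFun fun s => f s * g s := by
  obtain ⟨P, hP⟩ := hf
  obtain ⟨Q, hQ⟩ := hg
  exact ⟨P * Q, by simp [hP, hQ]⟩

theorem neg {f : ℂ → ℂ} (hf : IsPolynomialFun f) : IsPolynomialFun fun s => -f s := by
  obtain ⟨P, hP⟩ := hf
  exact ⟨-P, by simp [hP]⟩

theorem div_const {f : ℂ → ℂ} (hf : IsPolynomialFun f) (c : ℂ) :
    IsPolynomialFun fun s => f s / c := by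
  simpa only [div_eq_mul_inv] using hf.mul (const c⁻¹)

theorem sum {ι : Type*} (t : Finset ι) {f : ι → ℂ → ℂ} (hf : ∀ i ∈ t, IsPolynomialFun (f i)) :
    IsPolynomialFun fun s => ∑ i ∈ t, f i s := by
  classical
  induction t using Finset.induction_on with
  | empty => simpa using const 0
  | insert i t hi ih =>
    simp only [Finset.sum_insert hi]
    exact (hf i (by simp)).add (ih fun j hj => hf j (by simp [hj]))

theorem poch {f : ℂ → ℂ} (hf : IsPolynomialFun f) (n : ℕ) :
    IsPolynomialFun fun s => poch (f s) n := by
  induction n with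
  | zero => simpa using const 1
  | succ n ih =>
    simp only [poch_succ]
    exact ih.mul (hf.add (const n))

theorem continuous {f : ℂ → ℂ} (hf : IsPolynomialFun f) : Continuous f := by
  obtain ⟨P, hP⟩ := hf
  rw [funext hP]
  exact P.continuous

/-- The even naturals form an infinite set, and a polynomial is determined by its values on such a
set. -/
theorem eq_of_eq_even_natCast {f g : ℂ → ℂ} (hf : IsPolynomialFun f) (hg : IsPolynomialFun g)
    (h : ∀ N : ℕ, f (2 * N) = g (2 * N)) : f = g := by
  obtain ⟨P, hP⟩ := hf
  obtain ⟨Q, hQ⟩ := hg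
  have : P = Q := Polynomial.eq_of_infinite_eval_eq P Q
    (Set.infinite_of_injective_forall_mem (f := fun N : ℕ => (2 * N : ℂ))
      (fun a b hab => by simpa using hab) fun N => by
        rw [Set.mem_ofPred_eq, ← hP, ← hQ, h])
  ext s
  rw [hP, hQ, this]

end IsPolynomialFun

theorem isPolynomialFun_appellCoeff (p q l : ℕ) : IsPolynomialFun fun σ => appellCoeff p q σ l := by
  simp only [appellCoeff, appellF₂_eq_sum]
  refine (IsPolynomialFun.const _).mul (IsPolynomialFun.sum _ fun m _ =>
    IsPolynomialFun.sum _ fun n _ => IsPolynomialFun.div_const ?_ _)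
  refine IsPolynomialFun.mul (IsPolynomialFun.mul ((IsPolynomialFun.const _).mul
    (IsPolynomialFun.poch ?_ _)) (.const _)) (.const _)
  exact IsPolynomialFun.id.neg.div_const 2

/-! ### Power series on a real interval -/

/-- The coefficients of the even power series `∑ aₗ x^{2l}`. -/
noncomputable def evenExtension (a : ℕ → ℂ) (n : ℕ) : ℂ := if Even n then a (n / 2) else 0

theorem evenExtension_two_mul (a : ℕ → ℂ) (l : ℕ) : evenExtension a (2 * l) = a l := by
  simp [evenExtension]

theorem evenExtension_eq_zero (a : ℕ → ℂ) {n : ℕ} (hn : n ∉ Set.range fun l : ℕ => 2 * l) :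
    evenExtension a n = 0 := by
  rw [evenExtension, if_neg]
  rintro ⟨m, rfl⟩
  exact hn ⟨m, two_mul m⟩

theorem hasSum_evenExtension_iff {a : ℕ → ℂ} {x s : ℂ} :
    HasSum (fun n => evenExtension a n * x ^ n) s ↔ HasSum (fun l => a l * x ^ (2 * l)) s := by
  rw [← Function.Injective.hasSum_iff (mul_right_injective₀ two_ne_zero : Function.Injective
    fun l : ℕ => 2 * l)]
  · refine Eq.to_iff (congrArg (fun f => HasSum f s) (funext fun l => ?_))
    simp [evenExtension_two_mul]
  · intro n hn
    rw [evenExtension_eq_zero a hn, zero_mul]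

theorem summable_norm_evenExtension {a : ℕ → ℂ} {x : ℂ}
    (h : Summable fun l => ‖a l * x ^ (2 * l)‖) :
    Summable fun n => ‖evenExtension a n * x ^ n‖ := by
  rw [← Function.Injective.summable_iff (mul_right_injective₀ two_ne_zero : Function.Injective
    fun l : ℕ => 2 * l)]
  · simpa [Function.comp_def, evenExtension_two_mul] using h
  · intro n hn
    rw [evenExtension_eq_zero a hn, zero_mul, norm_zero]

theorem powerSeries_coeff_unique {a b : ℕ → ℂ} {f : ℝ → ℂ}
    (ha : ∀ τ : ℝ, |τ| < 1 → HasSum (fun n => a n * (τ : ℂ) ^ n) (f τ))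
    (hb : ∀ τ : ℝ, |τ| < 1 → HasSum (fun n => b n * (τ : ℂ) ^ n) (f τ)) : a = b := by
  let P : (ℕ → ℂ) → FormalMultilinearSeries ℝ ℝ ℂ := fun c n =>
    ContinuousMultilinearMap.mkPiRing ℝ (Fin n) (c n)
  have hP : ∀ c n, (P c).coeff n = c n := fun c n => by
    simp [P, FormalMultilinearSeries.coeff]
  have key : ∀ c : ℕ → ℂ, (∀ τ : ℝ, |τ| < 1 → HasSum (fun n => c n * (τ : ℂ) ^ n) (f τ)) →
      HasFPowerSeriesAt f (P c) 0 := by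
    intro c hc
    refine hasFPowerSeriesAt_iff.2 ?_
    filter_upwards [Metric.ball_mem_nhds (0 : ℝ) one_pos] with τ hτ
    rw [zero_add]
    refine (hc τ (by simpa using hτ)).congr_fun fun n => ?_
    rw [hP, Complex.real_smul, Complex.ofReal_pow, mul_comm]
  ext n
  rw [← hP a, ← hP b, (key a ha).eq_formalMultilinearSeries (key b hb)]

/-! ### The expansion in powers of `tanh α` -/

/-- As `|u|, |v| ≤ 1`, the Cauchy product of the two binomial series is dominated termwise by that
of the absolute series at `τ`, which is summable and independent of `x`. -/
theorem hasSum_integral_prod_cpow {X : Type*} [MeasurableSpace X] (μ : Measure X)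
    [IsProbabilityMeasure μ] {u v : X → ℝ} (hu : Measurable u) (hv : Measurable v)
    (hu1 : ∀ x, |u x| ≤ 1) (hv1 : ∀ x, |v x| ≤ 1) (b : ℂ) {τ : ℝ} (hτ : |τ| < 1) :
    (Summable fun n : ℕ => ‖(∑ ij ∈ Finset.HasAntidiagonal.antidiagonal n,
      poch b ij.1 / ij.1.factorial * (poch b ij.2 / ij.2.factorial) *
        ∫ x, (u x : ℂ) ^ ij.1 * (v x : ℂ) ^ ij.2 ∂μ) * (τ : ℂ) ^ n‖) ∧
    HasSum (fun n : ℕ => (∑ ij ∈ Finset.HasAntidiagonal.antidiagonal n,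
      poch b ij.1 / ij.1.factorial * (poch b ij.2 / ij.2.factorial) *
        ∫ x, (u x : ℂ) ^ ij.1 * (v x : ℂ) ^ ij.2 ∂μ) * (τ : ℂ) ^ n)
      (∫ x, (1 - (τ : ℂ) * u x) ^ (-b) * (1 - (τ : ℂ) * v x) ^ (-b) ∂μ) := by
  set B : ℕ → ℝ := fun n => ∑ ij ∈ Finset.HasAntidiagonal.antidiagonal n,
    ‖poch b ij.1 / ij.1.factorial * (τ : ℂ) ^ ij.1‖ *
      ‖poch b ij.2 / ij.2.factorial * (τ : ℂ) ^ ij.2‖ with hB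
  have hτ' : ‖(τ : ℂ)‖ < 1 := by rwa [Complex.norm_real]
  have hs := summable_norm_poch_series b τ hτ'
  have hBs : Summable B := by
    have := summable_norm_sum_mul_antidiagonal_of_summable_norm
      (f := fun n : ℕ => ‖poch b n / n.factorial * (τ : ℂ) ^ n‖)
      (g := fun n : ℕ => ‖poch b n / n.factorial * (τ : ℂ) ^ n‖) (by simpa using hs)
      (by simpa using hs)
    exact this.of_norm
  have hw : ∀ w : ℝ, |w| ≤ 1 → ‖(τ : ℂ) * w‖ < 1 := fun w hw => by
    rw [norm_mul, Complex.norm_real w]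
    exact mul_lt_one_of_nonneg_of_lt_one_left (norm_nonneg _) hτ' hw
  set F : ℕ → X → ℂ := fun n x => ∑ ij ∈ Finset.HasAntidiagonal.antidiagonal n,
    (poch b ij.1 / ij.1.factorial * ((τ : ℂ) * u x) ^ ij.1) *
      (poch b ij.2 / ij.2.factorial * ((τ : ℂ) * v x) ^ ij.2) with hF
  have hFB : ∀ n x, ‖F n x‖ ≤ B n := by
    intro n x
    have hpow : ∀ (w : ℝ) (i : ℕ), |w| ≤ 1 → ‖poch b i / i.factorial * ((τ : ℂ) * w) ^ i‖ ≤
        ‖poch b i / i.factorial * (τ : ℂ) ^ i‖ := by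
      intro w i hw
      rw [mul_pow, ← mul_assoc, norm_mul _ ((w : ℂ) ^ i), norm_pow, Complex.norm_real]
      exact mul_le_of_le_one_right (norm_nonneg _) (pow_le_one₀ (norm_nonneg _) hw)
    refine (norm_sum_le _ _).trans (Finset.sum_le_sum fun ij _ => ?_)
    rw [norm_mul]
    exact mul_le_mul (hpow _ _ (hu1 x)) (hpow _ _ (hv1 x)) (norm_nonneg _) (norm_nonneg _)
  have hFm : ∀ n, Measurable (F n) := by
    intro n
    refine Finset.measurable_sum _ fun ij _ => ?_
    fun_prop
  have hFint : ∀ n, ∫ x, F n x ∂μ = (∑ ij ∈ Finset.HasAntidiagonal.antidiagonal n,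
      poch b ij.1 / ij.1.factorial * (poch b ij.2 / ij.2.factorial) *
        ∫ x, (u x : ℂ) ^ ij.1 * (v x : ℂ) ^ ij.2 ∂μ) * (τ : ℂ) ^ n := by
    intro n
    have h : ∀ x, F n x = ∑ ij ∈ Finset.HasAntidiagonal.antidiagonal n,
        (poch b ij.1 / ij.1.factorial * (poch b ij.2 / ij.2.factorial) * (τ : ℂ) ^ n) *
          ((u x : ℂ) ^ ij.1 * (v x : ℂ) ^ ij.2) := fun x => by
      refine Finset.sum_congr rfl fun ij hij => ?_
      rw [← Finset.HasAntidiagonal.mem_antidiagonal.1 hij, pow_add]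
      ring
    simp_rw [h]
    rw [integral_finsetSum, Finset.sum_mul]
    · refine Finset.sum_congr rfl fun ij _ => ?_
      rw [integral_const_mul]; ring
    · intro ij _
      refine Integrable.const_mul ?_ _
      refine Integrable.of_bound (C := 1) (by fun_prop) (Filter.Eventually.of_forall fun x => ?_)
      rw [norm_mul, norm_pow, norm_pow, Complex.norm_real, Complex.norm_real]
      exact mul_le_one₀ (pow_le_one₀ (norm_nonneg _) (hu1 x)) (by positivity)
        (pow_le_one₀ (norm_nonneg _) (hv1 x))
  have hsum : ∀ x, HasSum (fun n => F n x)
      ((1 - (τ : ℂ) * u x) ^ (-b) * (1 - (τ : ℂ) * v x) ^ (-b)) := by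
    intro x
    have h1 := hw _ (hu1 x)
    have h2 := hw _ (hv1 x)
    have s1 := summable_norm_poch_series b _ h1
    have s2 := summable_norm_poch_series b _ h2
    rw [← (hasSum_poch_series b _ h1).tsum_eq, ← (hasSum_poch_series b _ h2).tsum_eq,
      tsum_mul_tsum_eq_tsum_sum_antidiagonal_of_summable_norm s1 s2]
    exact (summable_norm_sum_mul_antidiagonal_of_summable_norm s1 s2).of_norm.hasSum
  simp only [← hFint]
  constructor
  · refine Summable.of_nonneg_of_le (fun _ => norm_nonneg _) (fun n => ?_) hBs
    refine (norm_integral_le_of_norm_le_const (Filter.Eventually.of_forall (hFB n))).trans ?_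
    simp
  · exact hasSum_integral_of_dominated_convergence (fun n _ => B n)
      (fun n => (hFm n).aestronglyMeasurable)
      (fun n => Filter.Eventually.of_forall (hFB n))
      (Filter.Eventually.of_forall fun _ => hBs) (integrable_const _)
      (Filter.Eventually.of_forall hsum)

/-- The coefficients are finite sums of Pochhammer symbols in `σ` times integrals free of `σ`, hence
polynomial in `σ`. The factor in front of the integral is `cosh^{1+σ} α` when `τ = tanh α`. -/
theorem exists_isPolynomialFun_hasSum {X : Type*} [MeasurableSpace X] (μ : Measure X)
    [IsProbabilityMeasure μ] {u v : X → ℝ} (hu : Measurable u) (hv : Measurable v)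
    (hu1 : ∀ x, |u x| ≤ 1) (hv1 : ∀ x, |v x| ≤ 1) :
    ∃ d : ℕ → ℂ → ℂ, (∀ n, IsPolynomialFun (d n)) ∧ ∀ (σ : ℂ) (τ : ℝ), |τ| < 1 →
      HasSum (fun n => d n σ * (τ : ℂ) ^ n)
        ((1 - (τ : ℂ) ^ 2) ^ (-((1 + σ) / 2)) *
          ∫ x, (1 - (τ : ℂ) * u x) ^ (σ / 2) * (1 - (τ : ℂ) * v x) ^ (σ / 2) ∂μ) := by
  have hb : IsPolynomialFun fun σ => -(σ / 2) :=
    (IsPolynomialFun.id.div_const 2).neg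
  have ha : IsPolynomialFun fun σ => (1 + σ) / 2 :=
    ((IsPolynomialFun.const 1).add IsPolynomialFun.id).div_const 2
  refine ⟨fun n σ => ∑ km ∈ Finset.HasAntidiagonal.antidiagonal n,
    evenExtension (fun k => poch ((1 + σ) / 2) k / k.factorial) km.1 *
      (∑ ij ∈ Finset.HasAntidiagonal.antidiagonal km.2,
      poch (-(σ / 2)) ij.1 / ij.1.factorial * (poch (-(σ / 2)) ij.2 / ij.2.factorial) *
        ∫ x, (u x : ℂ) ^ ij.1 * (v x : ℂ) ^ ij.2 ∂μ), fun n => ?_, fun σ τ hτ => ?_⟩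
  · refine IsPolynomialFun.sum _ fun km _ => IsPolynomialFun.mul ?_ (IsPolynomialFun.sum _
      fun ij _ => (((hb.poch _).div_const _).mul ((hb.poch _).div_const _)).mul (.const _))
    unfold evenExtension
    split_ifs
    · exact (ha.poch _).div_const _
    · exact IsPolynomialFun.const 0
  · have hτ2 : ‖(τ : ℂ) ^ 2‖ < 1 := by
      rw [norm_pow, Complex.norm_real]; exact pow_lt_one₀ (norm_nonneg _) hτ two_ne_zero
    have h1 : HasSum (fun n => evenExtension (fun k => poch ((1 + σ) / 2) k / k.factorial) n *
        (τ : ℂ) ^ n) ((1 - (τ : ℂ) ^ 2) ^ (-((1 + σ) / 2))) := by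
      rw [hasSum_evenExtension_iff]
      simpa only [pow_mul] using hasSum_poch_series ((1 + σ) / 2) _ hτ2
    have s1 : Summable fun n => ‖evenExtension (fun k => poch ((1 + σ) / 2) k / k.factorial) n *
        (τ : ℂ) ^ n‖ := summable_norm_evenExtension (by
      simpa only [pow_mul] using summable_norm_poch_series ((1 + σ) / 2) _ hτ2)
    obtain ⟨s2, h2⟩ := hasSum_integral_prod_cpow μ hu hv hu1 hv1 (-(σ / 2)) hτ
    rw [neg_neg] at h2
    rw [← h1.tsum_eq, ← h2.tsum_eq, tsum_mul_tsum_eq_tsum_sum_antidiagonal_of_summable_norm s1 s2]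
    refine (summable_norm_sum_mul_antidiagonal_of_summable_norm s1 s2).of_norm.hasSum.congr_fun
      fun n => ?_
    rw [Finset.sum_mul]
    refine Finset.sum_congr rfl fun km hkm => ?_
    rw [← Finset.HasAntidiagonal.mem_antidiagonal.1 hkm, pow_add]
    ring

/-! ### Factorization of `ω²` and passage to arbitrary degree -/

theorem sqrt_cpow {a : ℝ} (ha : 0 < a) (σ : ℂ) : ((Real.sqrt a : ℝ) : ℂ) ^ σ = (a : ℂ) ^ (σ / 2) := by
  rw [Real.sqrt_eq_rpow, Complex.ofReal_cpow ha.le, ← Complex.cpow_mul]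
  · congr 1; push_cast; ring
  · rw [← Complex.ofReal_log ha.le, ← Complex.ofReal_mul, Complex.ofReal_im]
    simp [Real.pi_pos]
  · rw [← Complex.ofReal_log ha.le, ← Complex.ofReal_mul, Complex.ofReal_im]
    exact Real.pi_pos.le

/-- With `x = cos θ`, `y = cos φ` this is `|cos(θ-φ)| ≤ 1`; the sign change `x ↦ -x` later gives
`cos(θ+φ)`. -/
theorem abs_mul_add_sqrt_le_one {x y : ℝ} (hx : |x| ≤ 1) (hy : |y| ≤ 1) :
    |x * y + Real.sqrt (1 - x ^ 2) * Real.sqrt (1 - y ^ 2)| ≤ 1 := by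
  have hx2 := (sq_le_one_iff_abs_le_one x).2 hx
  have hy2 := (sq_le_one_iff_abs_le_one y).2 hy
  have e1 := Real.sq_sqrt (show 0 ≤ 1 - x ^ 2 by linarith)
  have e2 := Real.sq_sqrt (show 0 ≤ 1 - y ^ 2 by linarith)
  rw [← sq_le_one_iff_abs_le_one]
  nlinarith [sq_nonneg (x * Real.sqrt (1 - y ^ 2) - y * Real.sqrt (1 - x ^ 2))]

theorem cosh_mul_sqrt_omegaSq_cpow (α : ℝ) (σ : ℂ) {x y : ℝ} (hx : |x| ≤ 1) (hy : |y| ≤ 1) :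
    (Real.cosh α : ℂ) * (Real.sqrt (omegaSq α x y) : ℂ) ^ σ =
      (1 - (Real.tanh α : ℂ) ^ 2) ^ (-((1 + σ) / 2)) *
        ((1 - (Real.tanh α : ℂ) *
          (x * y + Real.sqrt (1 - x ^ 2) * Real.sqrt (1 - y ^ 2) : ℝ)) ^ (σ / 2) *
        (1 - (Real.tanh α : ℂ) *
          (x * y + -Real.sqrt (1 - x ^ 2) * Real.sqrt (1 - y ^ 2) : ℝ)) ^ (σ / 2)) := by
  have hc := Real.cosh_pos α
  have hc' : (Real.cosh α : ℂ) ≠ 0 := by exact_mod_cast hc.ne'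
  have hx2 := (sq_le_one_iff_abs_le_one x).2 hx
  have hy2 := (sq_le_one_iff_abs_le_one y).2 hy
  have e1 := Real.sq_sqrt (show 0 ≤ 1 - x ^ 2 by linarith)
  have e2 := Real.sq_sqrt (show 0 ≤ 1 - y ^ 2 by linarith)
  have hu := abs_mul_add_sqrt_le_one hx hy
  have hv : |x * y + -Real.sqrt (1 - x ^ 2) * Real.sqrt (1 - y ^ 2)| ≤ 1 := by
    have := abs_mul_add_sqrt_le_one (x := -x) (by rwa [abs_neg]) hy
    rw [← abs_neg] at this
    convert this using 2
    rw [neg_sq]; ring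
  have pu := one_sub_mul_pos (Real.abs_tanh_lt_one α) hu
  have pv := one_sub_mul_pos (Real.abs_tanh_lt_one α) hv
  -- The two roots have sum `2xy` and product `x² + y² - 1`. Both factors are positive, so complex
  -- powers split without a branch problem.
  have hW : omegaSq α x y = Real.cosh α ^ 2 *
      ((1 - Real.tanh α * (x * y + Real.sqrt (1 - x ^ 2) * Real.sqrt (1 - y ^ 2))) *
        (1 - Real.tanh α * (x * y + -Real.sqrt (1 - x ^ 2) * Real.sqrt (1 - y ^ 2)))) := by
    have hs : Real.sinh α = Real.tanh α * Real.cosh α := by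
      rw [Real.tanh_eq_sinh_div_cosh, div_mul_cancel₀ _ hc.ne']
    have hcs := Real.cosh_sq α
    rw [omegaSq]
    rw [hs] at hcs ⊢
    linear_combination -hcs + Real.cosh α ^ 2 * Real.tanh α ^ 2 *
      (e1 * Real.sqrt (1 - y ^ 2) ^ 2 + (1 - x ^ 2) * e2)
  rw [hW, Real.sqrt_mul (by positivity), Real.sqrt_sq hc.le, Complex.ofReal_mul,
    Complex.mul_cpow_ofReal_nonneg hc.le (Real.sqrt_nonneg _), sqrt_cpow (mul_pos pu pv),
    Complex.ofReal_mul, Complex.mul_cpow_ofReal_nonneg pu.le pv.le, one_sub_tanh_sq_cpow,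
    show -2 * -((1 + σ) / 2) = 1 + σ by ring, Complex.cpow_add _ _ hc', Complex.cpow_one]
  push_cast
  ring

theorem hasSum_appellCoeff (p q : ℕ) [NeZero p] [NeZero q] (σ : ℂ) (α : ℝ) :
    HasSum (fun l : ℕ => appellCoeff p q σ l * (Real.tanh α : ℂ) ^ (2 * l))
      (Real.cosh α * Z p q σ α) := by
  have hm1 : Measurable fun z : USphere q × USphere p => z.1.1 0 := by fun_prop
  have hm2 : Measurable fun z : USphere q × USphere p => z.2.1 (Fin.rev 0) := by fun_prop
  obtain ⟨d, hd, hsum⟩ := exists_isPolynomialFun_hasSum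
    ((sphereMeasure q).prod (sphereMeasure p))
    (u := fun z => z.1.1 0 * z.2.1 (Fin.rev 0) +
      Real.sqrt (1 - z.1.1 0 ^ 2) * Real.sqrt (1 - z.2.1 (Fin.rev 0) ^ 2))
    (v := fun z => z.1.1 0 * z.2.1 (Fin.rev 0) +
      -Real.sqrt (1 - z.1.1 0 ^ 2) * Real.sqrt (1 - z.2.1 (Fin.rev 0) ^ 2))
    (by fun_prop) (by fun_prop)
    (fun z => abs_mul_add_sqrt_le_one (abs_coord_le_one _ _) (abs_coord_le_one _ _))
    (fun z => by
      have := abs_mul_add_sqrt_le_one (x := -z.1.1 0) (y := z.2.1 (Fin.rev 0))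
        (by rw [abs_neg]; exact abs_coord_le_one _ _) (abs_coord_le_one _ _)
      rw [← abs_neg] at this
      convert this using 2
      rw [neg_sq]; ring)
  have hZ : ∀ (σ : ℂ) (α : ℝ),
      HasSum (fun n => d n σ * (Real.tanh α : ℂ) ^ n) (Real.cosh α * Z p q σ α) := by
    intro σ α
    have h := hsum σ (Real.tanh α) (Real.abs_tanh_lt_one α)
    rw [← integral_const_mul] at h
    rw [Z_eq_integral, ← integral_const_mul]
    convert h using 3 with z
    exact cosh_mul_sqrt_omegaSq_cpow α σ (abs_coord_le_one _ _) (abs_coord_le_one _ _)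
  -- Interpolation: at `σ = 2N` both expansions represent the same function of `τ = tanh α`, so
  -- their coefficients agree there. This also shows that odd powers of `τ` are absent for every
  -- `σ`.
  have hcoef : ∀ n, d n = fun σ => evenExtension (appellCoeff p q σ) n := by
    intro n
    refine (hd n).eq_of_eq_even_natCast ?_ fun N => ?_
    · unfold evenExtension
      split_ifs
      · exact isPolynomialFun_appellCoeff p q _
      · exact IsPolynomialFun.const 0
    · refine congrFun (powerSeries_coeff_unique (a := fun n => d n (2 * N))
        (b := evenExtension (appellCoeff p q (2 * N)))
        (f := fun τ => Real.cosh (Real.artanh τ) * Z p q (2 * N) (Real.artanh τ)) ?_ ?_) n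
      · intro τ hτ
        have := hZ (2 * N) (Real.artanh τ)
        rwa [Real.tanh_artanh (abs_lt.1 hτ)] at this
      · intro τ hτ
        have := hasSum_appellCoeff_even_degree p q N (Real.artanh τ)
        rwa [Real.tanh_artanh (abs_lt.1 hτ), ← hasSum_evenExtension_iff] at this
  have := hZ σ α
  simp only [hcoef] at this
  exact hasSum_evenExtension_iff.1 this

theorem summable_and_Z_eq_of_coeff (p q : ℕ) [NeZero p] [NeZero q] (σ : ℂ) (α : ℝ) (c : ℕ → ℂ)
    (hc : ∀ l, c l = appellCoeff p q σ l) :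
    Summable (fun l : ℕ => c l * (Real.tanh α : ℂ) ^ (2 * l)) ∧
      Z p q σ α = 1 / (Real.cosh α : ℂ) * ∑' l : ℕ, c l * (Real.tanh α : ℂ) ^ (2 * l) := by
  obtain rfl : c = appellCoeff p q σ := funext hc
  have h := hasSum_appellCoeff p q σ α
  have hc : (Real.cosh α : ℂ) ≠ 0 := by exact_mod_cast (Real.cosh_pos α).ne'
  refine ⟨h.summable, ?_⟩
  rw [h.tsum_eq]
  field_simp

/-! ### The limits of the coefficients -/

theorem tendsto_appellCoeff_of_eventually (p q l : ℕ) {f : ℂ → ℂ} {σ : ℂ}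
    (h : ∀ᶠ s in 𝓝[≠] σ, f s = appellCoeff p q s l) :
    Filter.Tendsto f (𝓝[≠] σ) (𝓝 (appellCoeff p q σ l)) :=
  (((isPolynomialFun_appellCoeff p q l).continuous.tendsto σ).mono_left
    nhdsWithin_le_nhds).congr' (h.mono fun _ hs => hs.symm)

/-- The integers other than `σ` form a closed set not containing `σ`, and the punctured
neighbourhood omits `σ` itself. -/
theorem eventually_ne_neg_natCast (σ : ℂ) :
    ∀ᶠ s in 𝓝[≠] σ, ∀ n : ℕ, s ≠ -((n : ℂ) + 2) := by
  have hd : IsClosed ((fun n : ℤ => (n : ℂ)) '' ({n : ℤ | (n : ℂ) ≠ σ})) :=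
    Complex.isClosedEmbedding_intCast.isClosedMap _ (isClosed_discrete _)
  have h1 : ∀ᶠ s in 𝓝 σ, s ∉ (fun n : ℤ => (n : ℂ)) '' ({n : ℤ | (n : ℂ) ≠ σ}) :=
    hd.isOpen_compl.mem_nhds (by rintro ⟨n, hn, h⟩; exact hn h)
  filter_upwards [nhdsWithin_le_nhds h1, self_mem_nhdsWithin] with s hs hs2 n hn
  refine hs ⟨-((n : ℤ) + 2), ?_, by simp [hn]⟩
  intro h
  refine hs2 ?_
  rw [Set.mem_singleton_iff, ← h, hn]
  simp

/-! ### `SO(4,1)` -/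

theorem poch_neg_two_mul (σ : ℂ) (m : ℕ) :
    poch (-σ) (2 * m) = 4 ^ m * poch (-σ / 2) m * poch ((1 - σ) / 2) m := by
  induction m with
  | zero => simp
  | succ m ih =>
    rw [show 2 * (m + 1) = 2 * m + 1 + 1 by ring, poch_succ, poch_succ, poch_succ, poch_succ, ih]
    push_cast; ring

theorem Z_four_one (σ : ℂ) (α : ℝ) :
    Z 4 1 σ α = ordinaryHypergeometric (-σ / 2) ((1 - σ) / 2) (2 : ℂ) ((Real.tanh α : ℂ) ^ 2) *
      (Real.cosh α : ℂ) ^ σ := by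
  have hsq : ∀ z : USphere 1, z.1 0 ^ 2 = 1 := fun z => by
    have h : ∑ i, z.1 i ^ 2 = 1 := by
      rw [← EuclideanSpace.real_norm_sq_eq, norm_eq_of_mem_sphere]; norm_num
    simpa using h
  have hc := Real.cosh_pos α
  have hs : Real.sinh α = Real.tanh α * Real.cosh α := by
    rw [Real.tanh_eq_sinh_div_cosh, div_mul_cancel₀ _ hc.ne']
  set w : USphere 1 × USphere 4 → ℝ := fun z => z.1.1 0 * z.2.1 (Fin.rev 0) with hw
  have hw1 : ∀ z, |w z| ≤ 1 := fun z => by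
    rw [hw, abs_mul]
    exact mul_le_one₀ (abs_coord_le_one _ _) (abs_nonneg _) (abs_coord_le_one _ _)
  have hom : ∀ z : USphere 1 × USphere 4,
      (Real.sqrt (omegaSq α (z.1.1 0) (z.2.1 (Fin.rev 0))) : ℂ) ^ σ =
      (Real.cosh α : ℂ) ^ σ * ((1 - (Real.tanh α : ℂ) * w z) ^ (- -σ) *
        (1 - (Real.tanh α : ℂ) * (0 : ℝ)) ^ (- -σ)) := by
    intro z
    have hp := one_sub_mul_pos (Real.abs_tanh_lt_one α) (hw1 z)
    have h : omegaSq α (z.1.1 0) (z.2.1 (Fin.rev 0)) =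
        (Real.cosh α * (1 - Real.tanh α * w z)) ^ 2 := by
      rw [omegaSq, hw, hs]
      have hcs := Real.cosh_sq α
      rw [hs] at hcs
      linear_combination -hcs + (Real.tanh α * Real.cosh α) ^ 2 *
        (1 - z.2.1 (Fin.rev 0) ^ 2) * hsq z.1
    rw [h, Real.sqrt_sq (mul_pos hc hp).le, Complex.ofReal_mul,
      Complex.mul_cpow_ofReal_nonneg hc.le hp.le]
    simp
  rw [Z_eq_integral]
  simp_rw [hom]
  rw [integral_const_mul, mul_comm]
  congr 1
  have hmw : Measurable w := by fun_prop
  obtain ⟨-, h⟩ := hasSum_integral_prod_cpow ((sphereMeasure 1).prod (sphereMeasure 4))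
    -- The choice `v = 0` makes the second factor 1, so the two-factor expansion serves for a single
    -- binomial series; only the index `(n, 0)` contributes.
    hmw (measurable_const (a := (0 : ℝ))) hw1 (by simp) (-σ) (Real.abs_tanh_lt_one α)
  have hcoef : ∀ n : ℕ, (∑ ij ∈ Finset.HasAntidiagonal.antidiagonal n,
      poch (-σ) ij.1 / ij.1.factorial * (poch (-σ) ij.2 / ij.2.factorial) *
        ∫ z, (w z : ℂ) ^ ij.1 * ((0 : ℝ) : ℂ) ^ ij.2
          ∂((sphereMeasure 1).prod (sphereMeasure 4))) =
      evenExtension (fun m => poch (-σ / 2) m * poch ((1 - σ) / 2) m /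
        (poch 2 m * m.factorial)) n := by
    intro n
    rw [Finset.sum_eq_single (n, 0)]
    · have h1 : ∀ z : USphere 1 × USphere 4, (w z : ℂ) ^ n * ((0 : ℝ) : ℂ) ^ 0 =
          ((z.1.1 0 : ℝ) : ℂ) ^ n * ((z.2.1 (Fin.rev 0) : ℝ) : ℂ) ^ n := fun z => by
        rw [hw]; push_cast; ring
      simp_rw [h1]
      rw [integral_prod_coord_pow, evenExtension]
      split_ifs with he
      · obtain ⟨m, rfl⟩ := he
        rw [← two_mul, sphereMoment_two_mul, sphereMoment_two_mul, Nat.mul_div_cancel_left m two_pos]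
        have hp1 : poch (1 / 2) m ≠ 0 := poch_ne_zero_of_re_pos (by norm_num) m
        have hp2 : poch 2 m ≠ 0 := poch_ne_zero_of_re_pos (by norm_num) m
        have hf : (m.factorial : ℂ) ≠ 0 := by exact_mod_cast m.factorial_ne_zero
        rw [poch_neg_two_mul, factorial_two_mul, show ((4 : ℕ) : ℂ) / 2 = 2 by norm_num, show ((1 : ℕ) : ℂ) / 2 = 1 / 2 by simp]
        simp only [poch_zero, Nat.factorial_zero]
        field_simp
        simp
      · simp [sphereMoment, he]
    · rintro ⟨i, j⟩ hij hne
      rw [Finset.HasAntidiagonal.mem_antidiagonal] at hij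
      have : j ≠ 0 := by rintro rfl; exact hne (by simp [← hij])
      simp [this]
    · intro h
      simp at h
  simp only [hcoef] at h
  rw [hasSum_evenExtension_iff] at h
  rw [← h.tsum_eq, ordinaryHypergeometric_eq_tsum]
  refine tsum_congr fun m => ?_
  rw [smul_eq_mul, pow_mul]
  simp only [poch, div_eq_mul_inv, mul_inv]
  ring

end ZonalSO

/-! ### The formulas for `SO(4,1)`, `SO(3,2)` and `SO(4,2)` -/

theorem mainTheorem4 :
    -- `SO(4,1)`
    (∀ (σ : ℂ) (α : ℝ),
      ZonalSO.Z 4 1 σ α =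
        ordinaryHypergeometric (-σ / 2) ((1 - σ) / 2) (2 : ℂ) ((Real.tanh α : ℂ) ^ 2) *
          (Real.cosh α : ℂ) ^ σ) ∧
    -- `SO(3,2)`: the series of Appell functions
    (∀ (σ : ℂ) (α : ℝ),
      Summable (fun l : ℕ => ZonalSO.appellCoeff 3 2 σ l * (Real.tanh α : ℂ) ^ (2 * l)) ∧
      ZonalSO.Z 3 2 σ α = 1 / (Real.cosh α : ℂ) *
        ∑' l : ℕ, ZonalSO.appellCoeff 3 2 σ l * (Real.tanh α : ℂ) ^ (2 * l)) ∧
    -- `SO(3,2)`: the series of terminating `₃F₂(1)`, where all of its terms are defined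
    (∀ (σ : ℂ) (α : ℝ), (∀ n : ℕ, σ ≠ -((n : ℂ) + 2)) →
      Summable (fun l : ℕ => ZonalSO.coeff₃₂ σ l * (Real.tanh α : ℂ) ^ (2 * l)) ∧
      ZonalSO.Z 3 2 σ α = 1 / (Real.cosh α : ℂ) *
        ∑' l : ℕ, ZonalSO.coeff₃₂ σ l * (Real.tanh α : ℂ) ^ (2 * l)) ∧
    -- `SO(3,2)`: at the exceptional `σ` the terms are read as limits
    (∀ σ : ℂ, ∃ c : ℕ → ℂ,
      (∀ l : ℕ, Filter.Tendsto (fun s : ℂ => ZonalSO.coeff₃₂ s l) (𝓝[≠] σ) (𝓝 (c l))) ∧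
      ∀ α : ℝ, Summable (fun l : ℕ => c l * (Real.tanh α : ℂ) ^ (2 * l)) ∧
        ZonalSO.Z 3 2 σ α = 1 / (Real.cosh α : ℂ) *
          ∑' l : ℕ, c l * (Real.tanh α : ℂ) ^ (2 * l)) ∧
    -- `SO(4,2)`: the series of Appell functions
    (∀ (σ : ℂ) (α : ℝ),
      Summable (fun l : ℕ => ZonalSO.appellCoeff 4 2 σ l * (Real.tanh α : ℂ) ^ (2 * l)) ∧
      ZonalSO.Z 4 2 σ α = 1 / (Real.cosh α : ℂ) *
        ∑' l : ℕ, ZonalSO.appellCoeff 4 2 σ l * (Real.tanh α : ℂ) ^ (2 * l)) ∧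
    -- `SO(4,2)`: the series of terminating `₃F₂(1)`, where all of its terms are defined
    (∀ (σ : ℂ) (α : ℝ), (∀ n : ℕ, σ ≠ -(2 * (n : ℂ) + 2)) →
      Summable (fun l : ℕ => ZonalSO.coeff₄₂ σ l * (Real.tanh α : ℂ) ^ (2 * l)) ∧
      ZonalSO.Z 4 2 σ α = 1 / (Real.cosh α : ℂ) *
        ∑' l : ℕ, ZonalSO.coeff₄₂ σ l * (Real.tanh α : ℂ) ^ (2 * l)) ∧
    -- `SO(4,2)`: at the exceptional `σ` the terms are read as limits
    (∀ σ : ℂ, ∃ c : ℕ → ℂ,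
      (∀ l : ℕ, Filter.Tendsto (fun s : ℂ => ZonalSO.coeff₄₂ s l) (𝓝[≠] σ) (𝓝 (c l))) ∧
      ∀ α : ℝ, Summable (fun l : ℕ => c l * (Real.tanh α : ℂ) ^ (2 * l)) ∧
        ZonalSO.Z 4 2 σ α = 1 / (Real.cosh α : ℂ) *
          ∑' l : ℕ, c l * (Real.tanh α : ℂ) ^ (2 * l)) := by
  have h32 : ∀ (σ : ℂ) (l : ℕ), ∀ᶠ s in 𝓝[≠] σ,
      ZonalSO.coeff₃₂ s l = ZonalSO.appellCoeff 3 2 s l := fun σ l =>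
    (ZonalSO.eventually_ne_neg_natCast σ).mono fun s hs => ZonalSO.coeff₃₂_eq_appellCoeff hs l
  have h42 : ∀ (σ : ℂ) (l : ℕ), ∀ᶠ s in 𝓝[≠] σ,
      ZonalSO.coeff₄₂ s l = ZonalSO.appellCoeff 4 2 s l := fun σ l =>
    (ZonalSO.eventually_ne_neg_natCast σ).mono fun s hs => ZonalSO.coeff₄₂_eq_appellCoeff
      -- The excluded values for `SO(4,2)` are among those for `SO(3,2)`: `2n + 2` is the case of
      -- index `2n`.
      (fun n => by simpa using hs (2 * n)) l
  refine ⟨ZonalSO.Z_four_one,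
    fun σ α => ZonalSO.summable_and_Z_eq_of_coeff 3 2 σ α _ fun _ => rfl,
    fun σ α h => ZonalSO.summable_and_Z_eq_of_coeff 3 2 σ α _ (ZonalSO.coeff₃₂_eq_appellCoeff h),
    fun σ => ⟨ZonalSO.appellCoeff 3 2 σ,
      fun l => ZonalSO.tendsto_appellCoeff_of_eventually 3 2 l (h32 σ l),
      fun α => ZonalSO.summable_and_Z_eq_of_coeff 3 2 σ α _ fun _ => rfl⟩,
    fun σ α => ZonalSO.summable_and_Z_eq_of_coeff 4 2 σ α _ fun _ => rfl,
    fun σ α h => ZonalSO.summable_and_Z_eq_of_coeff 4 2 σ α _ (ZonalSO.coeff₄₂_eq_appellCoeff h),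
    fun σ => ⟨ZonalSO.appellCoeff 4 2 σ,
      fun l => ZonalSO.tendsto_appellCoeff_of_eventually 4 2 l (h42 σ l),
      fun α => ZonalSO.summable_and_Z_eq_of_coeff 4 2 σ α _ fun _ => rfl⟩⟩
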